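/- **Setting.** Let $M$ be a topological space (for instance the spatial manifold $\Sigma$) and let $G$ be a locally compact Hausdorff group that is unimodular. *Graphs.* An edge is a continuous curve $\gamma:[0,1]\to M$ without self-intersections, except that possibly $\gamma(0)=\gamma(1)$. Its source is $\gamma(0)$ and its target is $\gamma(1)$. A graph $\Gamma=\{\gamma_1,\dots,\gamma_N\}$ consists of finitely many edges such that distinct edges meet at most in sources or targets. The path groupoid of $\Gamma$ is the groupoid freely generated by $\gamma_1,\dots,\gamma_N$ over the set of vertices. A holonomy map is a map $\mathfrak h$ from the path groupoid to $G$ with $\mathfrak h(\gamma\circ\gamma')=\mathfrak h(\gamma)\mathfrak h(\gamma')$ whenever $\gamma$ ends where $\gamma'$ starts. The configuration space is $$\bar{\mathcal A}_\Gamma=\{(\mathfrak h(\gamma_1),\dots,\mathfrak h(\gamma_N)) : \mathfrak h \text{ a holonomy map}\}\subseteq G^N$$ with the topology of $G^N$, and $C_0(\bar{\mathcal A}_\Gamma)$ is the $C^*$-algebra of complex continuous functions on it that vanish at infinity. *Surfaces.* An oriented surface is a subset $S\subseteq M$ together with disjoint open sets "above $S$" and "below $S$", both disjoint from $S$, such that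 their union with $S$ is open and $S$ lies in the closure of each. An edge is outgoing (ingoing) with respect to $S$ if its source (target) lies on $S$; it lies above (below) $S$ there if $\gamma(t)$ is above (below) $S$ for all $t$ close to, but different from, the parameter of that end point. Put $\iota_L(S,\gamma)=1$ ($-1$) if $\gamma$ is outgoing and lies above (below) $S$, $\iota_R(S,\gamma)=-1$ ($1$) if $\gamma$ is ingoing and lies above (below) $S$, and $0$ in all other cases. Surfaces $\breve S=\{S_1,\dots,S_N\}$ have the *simple surface intersection property* for $\Gamma$ if each $\gamma_i$ meets $S_i$ exactly once, namely in its target, lies above $S_i$ there, and meets no $S_j$ with $j\neq i$. *Flux group.* $\bar G_{\breve S,\Gamma}\subseteq (G\times G)^N$ is the group of all finite products of tuples $(\rho_S(\gamma_1),\dots,\rho_S(\gamma_N))$ with $\rho_S(\gamma)=(o_L(S)^{\iota_L(S,\gamma)},o_R(S)^{\iota_R(S,\gamma)})$, where $S\in\breve S$ and $o_L,o_R:\breve S\to G$ are arbitrary maps. It carries the subspace topology and a (regular) Haar measure $\mu=\mu_{\breve S,\Gamma}$ with any normalisation. Under the simple surface intersection property the first components are trivial; an element of $\bar G_{\breve S,\Gamma}$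 is then written $\rho=(\rho_{S_1}(\gamma_1),\dots,\rho_{S_N}(\gamma_N))\in G^N$, using the second components. The left action on $C_0(\bar{\mathcal A}_\Gamma)$ is $$(\alpha^N_{\overleftarrow L}(\rho)f)(\mathfrak h(\gamma_1),\dots,\mathfrak h(\gamma_N))=f(\rho_{S_1}(\gamma_1)^{-1}\mathfrak h(\gamma_1),\dots,\rho_{S_N}(\gamma_N)^{-1}\mathfrak h(\gamma_N)).$$ A triple $(K,A,\alpha)$ is a $C^*$-dynamical system if $K$ is a locally compact group, $A$ a $C^*$-algebra and $\alpha$ a homomorphism from $K$ to the group of $*$-automorphisms of $A$ such that $\rho\mapsto\alpha(\rho)a$ is norm continuous for every $a\in A$. $L^1(K,A,\alpha)$ denotes the space of (strongly measurable) integrable functions $F:K\to A$ modulo null functions, with pointwise linear structure and norm $\|F\|_1=\int_K\|F(\rho)\|\,d\mu(\rho)$. **Proposition.** Let $\breve S=\{S_1,\dots,S_N\}$ have the simple surface intersection property for $\Gamma$. Then $(\bar G_{\breve S,\Gamma},C_0(\bar{\mathcal A}_\Gamma),\alpha^N_{\overleftarrow L})$ is a $C^*$-dynamical system. Moreover, for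 $\alpha=\alpha^N_{\overleftarrow L}$, and likewise for every $\alpha$ for which $(\bar G_{\breve S,\Gamma},C_0(\bar{\mathcal A}_\Gamma),\alpha)$ is a $C^*$-dynamical system, the following holds. For all integrable $F,\hat F:\bar G_{\breve S,\Gamma}\to C_0(\bar{\mathcal A}_\Gamma)$ the integral $$(F*\hat F)(\tilde\rho)=\int_{\bar G_{\breve S,\Gamma}}F(\rho)\,\alpha(\rho)\big(\hat F(\rho^{-1}\tilde\rho)\big)\,d\mu(\rho)$$ converges absolutely for almost every $\tilde\rho$. This product and the involution $$F^*(\rho)=\alpha(\rho)\big(F^+(\rho^{-1})\big),\qquad F^+(\rho)=\overline{F(\rho)},$$ are well defined on $L^1(\bar G_{\breve S,\Gamma},C_0(\bar{\mathcal A}_\Gamma),\alpha)$ and turn it into a Banach $*$-algebra: it is complete, the product is bilinear and associative with $\|F*\hat F\|_1\le\|F\|_1\|\hat F\|_1$, and the involution is conjugate linear, isometric and involutive with $(F*\hat F)^*=\hat F^{*}*F^{*}$. -/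

import Mathlib

open MeasureTheory Topology Filter CategoryTheory
open scoped ZeroAtInfty

universe u v

namespace HolonomyFlux

/-! ### Curves, graphs and oriented surfaces in the space `M` -/

/-- An edge in `M`, given by a parametrised representative: a continuous curve on `[0,1]` without
self-intersections, except that source and target may coincide. No differentiability is demanded,
so that `C^k`, analytic and semi-analytic edges are all included. -/
structure Edge (M : Type u) [TopologicalSpace M] where
  toFun : C(unitInterval, M)
  simple : ∀ s t : unitInterval, toFun s = toFun t →
    s = t ∨ (s = 0 ∧ t = 1) ∨ (s = 1 ∧ t = 0)

/-- Source vertex of an edge. -/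
def Edge.source {M : Type u} [TopologicalSpace M] (e : Edge M) : M := e.toFun 0

/-- Target vertex of an edge. -/
def Edge.target {M : Type u} [TopologicalSpace M] (e : Edge M) : M := e.toFun 1

/-- A graph in `M` with `N` independent edges: distinct edges meet at most in source or target
points. -/
structure Graph (M : Type u) [TopologicalSpace M] (N : ℕ) where
  edge : Fin N → Edge M
  independent : ∀ i j, i ≠ j → ∀ s t : unitInterval, (edge i).toFun s = (edge j).toFun t →
    (s = 0 ∨ s = 1) ∧ (t = 0 ∨ t = 1)

/-- An oriented surface in `M`: a two-sided subset together with the choice of its upper and lower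
side in a neighbourhood. A co-oriented embedded hypersurface of a manifold, with the two sides of a
tubular neighbourhood, is of this form. -/
structure OrientedSurface (M : Type u) [TopologicalSpace M] where
  carrier : Set M
  above : Set M
  below : Set M
  isOpen_above : IsOpen above
  isOpen_below : IsOpen below
  isOpen_neighbourhood : IsOpen (carrier ∪ above ∪ below)
  disjoint_above_below : Disjoint above below
  disjoint_carrier_above : Disjoint carrier above
  disjoint_carrier_below : Disjoint carrier below
  carrier_subset_above : carrier ⊆ closure above
  carrier_subset_below : carrier ⊆ closure below

section Intersection

variable {M : Type u} [TopologicalSpace M]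

/-- The edge is outgoing with respect to `S`, and its initial part lies in the side `U`. -/
def OutgoingIn (S : OrientedSurface M) (U : Set M) (e : Edge M) : Prop :=
  e.source ∈ S.carrier ∧ ∀ᶠ t in 𝓝[>] (0 : unitInterval), e.toFun t ∈ U

/-- The edge is ingoing with respect to `S`, and its final part lies in the side `U`. -/
def IngoingIn (S : OrientedSurface M) (U : Set M) (e : Edge M) : Prop :=
  e.target ∈ S.carrier ∧ ∀ᶠ t in 𝓝[<] (1 : unitInterval), e.toFun t ∈ U

open Classical in
/-- The intersection function `ι_L`: `1` (`-1`) for edges that are outgoing and lie above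
(below) the surface, `0` otherwise. -/
noncomputable def iotaL (S : OrientedSurface M) (e : Edge M) : ℤ :=
  if OutgoingIn S S.above e then 1 else if OutgoingIn S S.below e then -1 else 0

open Classical in
/-- The intersection function `ι_R`: `-1` (`1`) for edges that are ingoing and lie above
(below) the surface, `0` otherwise. -/
noncomputable def iotaR (S : OrientedSurface M) (e : Edge M) : ℤ :=
  if IngoingIn S S.above e then -1 else if IngoingIn S S.below e then 1 else 0

/-- The simple surface intersection property of the surfaces `S_1, …, S_N` for a graph with edges
`γ_1, …, γ_N`: the edge `γ_i` meets the surface `S_i` only once, in its target vertex, it lies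
above `S_i`, and it meets no other surface of the set. -/
structure SimpleSurfaceIntersectionProperty {N : ℕ} (Γ : Graph M N)
    (S : Fin N → OrientedSurface M) : Prop where
  mem_iff : ∀ i j (t : unitInterval), (Γ.edge i).toFun t ∈ (S j).carrier ↔ i = j ∧ t = 1
  lies_above : ∀ i, IngoingIn (S i) (S i).above (Γ.edge i)

end Intersection

/-! ### The flux group -/

section Flux

variable {M : Type u} [TopologicalSpace M] (G : Type v) [Group G]

/-- The values `(ρ_S(γ_1), …, ρ_S(γ_N))` of the group-valued quantum fluxes on the graph, where
`ρ_S(γ) = (o_L(S) ^ ι_L(S,γ), o_R(S) ^ ι_R(S,γ))` with arbitrary maps `o_L`, `o_R` from the set of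
surfaces to `G`. -/
def fluxImages {N : ℕ} (Γ : Graph M N) {J : Type} (S : J → OrientedSurface M) :
    Set (Fin N → G × G) :=
  {x | ∃ (oL oR : J → G) (j : J), ∀ i,
    x i = (oL j ^ iotaL (S j) (Γ.edge i), oR j ^ iotaR (S j) (Γ.edge i))}

/-- The flux group: all finite products of values of group-valued quantum fluxes. -/
def fluxGroup {N : ℕ} (Γ : Graph M N) {J : Type} (S : J → OrientedSurface M) :
    Subgroup (Fin N → G × G) :=
  { Submonoid.closure (fluxImages G Γ S) with
    inv_mem' := by
      intro x hx
      change x ∈ Submonoid.closure (fluxImages G Γ S) at hx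
      change x⁻¹ ∈ Submonoid.closure (fluxImages G Γ S)
      induction hx using Submonoid.closure_induction with
      | mem x h =>
        obtain ⟨oL, oR, j, h⟩ := h
        refine Submonoid.subset_closure ⟨oL⁻¹, oR⁻¹, j, fun i => ?_⟩
        simp [h i]
      | one => simp
      | mul x y _ _ hx hy =>
        rw [mul_inv_rev]
        exact mul_mem hy hx }

end Flux

/-! ### Holonomies and the configuration space -/

section Holonomy

variable {M : Type u} [TopologicalSpace M]

/-- The vertices of a graph. -/
def Graph.Vertex {N : ℕ} (Γ : Graph M N) : Type u :=
  {x : M // ∃ i, x = (Γ.edge i).source ∨ x = (Γ.edge i).target}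

instance Graph.quiver {N : ℕ} (Γ : Graph M N) : Quiver Γ.Vertex where
  Hom a b := {i : Fin N // (Γ.edge i).source = a.1 ∧ (Γ.edge i).target = b.1}

/-- The path groupoid of a graph, freely generated by its edges. -/
abbrev Graph.PathGroupoid {N : ℕ} (Γ : Graph M N) : Type u := Quiver.FreeGroupoid Γ.Vertex

/-- The edge `γ_i` as an element of the path groupoid. -/
def Graph.path {N : ℕ} (Γ : Graph M N) (i : Fin N) :
    (Quiver.FreeGroupoid.of Γ.Vertex).obj ⟨(Γ.edge i).source, i, Or.inl rfl⟩ ⟶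
      (Quiver.FreeGroupoid.of Γ.Vertex).obj ⟨(Γ.edge i).target, i, Or.inr rfl⟩ :=
  (Quiver.FreeGroupoid.of Γ.Vertex).map (X := ⟨(Γ.edge i).source, i, Or.inl rfl⟩)
    (Y := ⟨(Γ.edge i).target, i, Or.inr rfl⟩) ⟨i, rfl, rfl⟩

/-- A holonomy map: a groupoid morphism from the path groupoid to the group `G`, the composition
`p ≫ q` being the path that runs through `p` first. -/
structure HolonomyMap (G : Type v) [Group G] {N : ℕ} (Γ : Graph M N) where
  hol : ∀ {a b : Γ.PathGroupoid}, (a ⟶ b) → G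
  hol_comp : ∀ {a b c : Γ.PathGroupoid} (p : a ⟶ b) (q : b ⟶ c),
    hol (p ≫ q) = hol p * hol q

/-- The configuration space of generalised connections: all tuples `(𝔥(γ_1), …, 𝔥(γ_N)) ∈ G^N` for
holonomy maps `𝔥`, with the topology of `G^N`. -/
def configSpace (G : Type v) [Group G] {N : ℕ} (Γ : Graph M N) : Set (Fin N → G) :=
  {x | ∃ h : HolonomyMap G Γ, ∀ i, x i = h.hol (Γ.path i)}

/-- Since the edges generate the path groupoid freely, every tuple is a tuple of holonomies. -/
theorem mem_configSpace (G : Type v) [Group G] {N : ℕ} (Γ : Graph M N) (x : Fin N → G) :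
    x ∈ configSpace G Γ := by
  let φ : Γ.Vertex ⥤q SingleObj Gᵐᵒᵖ :=
    { obj := fun _ => SingleObj.star _
      map := fun {a b} e => (MulOpposite.op (x e.1) : Gᵐᵒᵖ) }
  let F : Γ.PathGroupoid ⥤ SingleObj Gᵐᵒᵖ := Quiver.FreeGroupoid.lift φ
  refine ⟨⟨fun {a b} p => MulOpposite.unop (show Gᵐᵒᵖ from F.map p), ?_⟩, ?_⟩
  · intro a b c p q
    have h := F.map_comp p q
    rw [SingleObj.comp_as_mul] at h
    exact congrArg MulOpposite.unop h
  · intro i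
    exact congrArg MulOpposite.unop (mul_one (MulOpposite.op (x i))).symm

end Holonomy

/-! ### The left action of the flux group on the analytic holonomy algebra -/

section Action

variable {M : Type u} [TopologicalSpace M] {G : Type v} [Group G] [TopologicalSpace G]
  [IsTopologicalGroup G]

/-- Left translation `(𝔥(γ_1), …, 𝔥(γ_N)) ↦ (g_1 𝔥(γ_1), …, g_N 𝔥(γ_N))` of the configuration
space. -/
def leftTranslation {N : ℕ} (Γ : Graph M N) (g : Fin N → G) :
    configSpace G Γ ≃ₜ configSpace G Γ where
  toFun h := ⟨g * h.1, mem_configSpace G Γ _⟩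
  invFun h := ⟨g⁻¹ * h.1, mem_configSpace G Γ _⟩
  left_inv h := Subtype.ext (inv_mul_cancel_left g h.1)
  right_inv h := Subtype.ext (mul_inv_cancel_left g h.1)
  continuous_toFun := by fun_prop
  continuous_invFun := by fun_prop

/-- The automorphism of `C₀(X)` induced by a homeomorphism of `X`. -/
noncomputable def compHomeo {X : Type*} [TopologicalSpace X] (e : X ≃ₜ X) :
    C₀(X, ℂ) ≃⋆ₐ[ℂ] C₀(X, ℂ) where
  toFun f := f.comp e.toCocompactMap
  invFun f := f.comp e.symm.toCocompactMap
  left_inv f := by ext x; simp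
  right_inv f := by ext x; simp
  map_add' _ _ := rfl
  map_mul' _ _ := rfl
  map_star' _ := rfl
  map_smul' _ _ := rfl

/-- The components `(ρ_{S_1}(γ_1), …, ρ_{S_N}(γ_N)) ∈ G^N` of an element of the flux group that
belong to ingoing edges. Under the simple surface intersection property the components that belong
to outgoing edges are trivial. -/
def ingoingFlux {N : ℕ} {Γ : Graph M N} {J : Type} {S : J → OrientedSurface M}
    (ρ : fluxGroup G Γ S) : Fin N → G := fun i => (ρ.1 i).2

/-- The left action of the flux group on the analytic holonomy algebra,
`(α(ρ) f)(𝔥) = f(ρ_{S_1}(γ_1)⁻¹ 𝔥(γ_1), …, ρ_{S_N}(γ_N)⁻¹ 𝔥(γ_N))`. -/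
noncomputable def leftAction {N : ℕ} (Γ : Graph M N) {J : Type} (S : J → OrientedSurface M) :
    fluxGroup G Γ S →* (C₀(configSpace G Γ, ℂ) ≃⋆ₐ[ℂ] C₀(configSpace G Γ, ℂ)) where
  toFun ρ := compHomeo (leftTranslation Γ (ingoingFlux ρ)⁻¹)
  map_one' := by
    ext f x
    refine congrArg f (Subtype.ext ?_)
    funext i
    simp [leftTranslation, ingoingFlux]
  map_mul' ρ τ := by
    ext f x
    refine congrArg f (Subtype.ext ?_)
    funext i
    simp [leftTranslation, ingoingFlux, mul_assoc]

end Action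

/-! ### `C*`-dynamical systems and twisted convolution -/

/-- `(K, A, α)` is a `C*`-dynamical system: `K` is locally compact and the action `α` of `K` by
`*`-automorphisms of the `C*`-algebra `A` is point-norm continuous. -/
structure IsCStarDynamicalSystem {K : Type*} [Group K] [TopologicalSpace K] {A : Type*}
    [NonUnitalCStarAlgebra A] (α : K →* (A ≃⋆ₐ[ℂ] A)) : Prop where
  locallyCompact : LocallyCompactSpace K
  continuous_apply : ∀ a : A, Continuous fun ρ : K => α ρ a

/-- The twisted convolution `(F ∗ H)(τ) = ∫ F(ρ) α(ρ)(H(ρ⁻¹ τ)) dμ(ρ)`. -/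
noncomputable def twistedConvolution {K : Type*} [Group K] [MeasurableSpace K] {A : Type*}
    [NonUnitalCStarAlgebra A] (α : K →* (A ≃⋆ₐ[ℂ] A)) (μ : Measure K) (F H : K → A) (τ : K) : A :=
  ∫ ρ, F ρ * α ρ (H (ρ⁻¹ * τ)) ∂μ

/-- The involution `F^*(ρ) = α(ρ)(F^+(ρ⁻¹))`, where `F^+(ρ) = F(ρ)^*` pointwise. -/
def twistedInvolution {K : Type*} [Group K] {A : Type*}
    [NonUnitalCStarAlgebra A] (α : K →* (A ≃⋆ₐ[ℂ] A)) (F : K → A) (ρ : K) : A :=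
  α ρ (star (F ρ⁻¹))

/-- The complex normed space `X` is a Banach `*`-algebra (in general without unit) with the
product `mul` and the isometric involution `inv`. -/
structure IsBanachStarAlgebra {X : Type*} [NormedAddCommGroup X] [NormedSpace ℂ X]
    (mul : X → X → X) (inv : X → X) : Prop where
  complete : CompleteSpace X
  add_mul : ∀ x y z, mul (x + y) z = mul x z + mul y z
  mul_add : ∀ x y z, mul x (y + z) = mul x y + mul x z
  smul_mul : ∀ (c : ℂ) x y, mul (c • x) y = c • mul x y
  mul_smul : ∀ (c : ℂ) x y, mul x (c • y) = c • mul x y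
  mul_assoc : ∀ x y z, mul (mul x y) z = mul x (mul y z)
  norm_mul_le : ∀ x y, ‖mul x y‖ ≤ ‖x‖ * ‖y‖
  inv_inv : ∀ x, inv (inv x) = x
  inv_add : ∀ x y, inv (x + y) = inv x + inv y
  inv_smul : ∀ (c : ℂ) x, inv (c • x) = star c • inv x
  inv_mul : ∀ x y, inv (mul x y) = mul (inv y) (inv x)
  norm_inv : ∀ x, ‖inv x‖ = ‖x‖

/-- `L¹(K, A, α)`, the space of `A`-valued integrable functions modulo null functions with norm
`∫ ‖F(ρ)‖ dμ(ρ)`, is a Banach `*`-algebra whose product is the twisted convolution and whose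
involution is the twisted involution. For each pair of integrable functions the integral that
defines the convolution converges absolutely almost everywhere. -/
def IsTwistedConvolutionAlgebra {K : Type*} [Group K] [MeasurableSpace K] {A : Type*}
    [NonUnitalCStarAlgebra A] (α : K →* (A ≃⋆ₐ[ℂ] A)) (μ : Measure K) : Prop :=
  ∃ (mul : (K →₁[μ] A) → (K →₁[μ] A) → (K →₁[μ] A)) (inv : (K →₁[μ] A) → (K →₁[μ] A)),
    (∀ (F H : K → A) (hF : Integrable F μ) (hH : Integrable H μ),
      (∀ᵐ τ ∂μ, Integrable (fun ρ => F ρ * α ρ (H (ρ⁻¹ * τ))) μ) ∧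
        mul (hF.toL1 F) (hH.toL1 H) =ᵐ[μ] twistedConvolution α μ F H) ∧
    (∀ (F : K → A) (hF : Integrable F μ), inv (hF.toL1 F) =ᵐ[μ] twistedInvolution α F) ∧
    IsBanachStarAlgebra mul inv

end HolonomyFlux

open HolonomyFlux

/-! Every edge meets only its own surface, and only in its target. Hence `ι_L` vanishes throughout
and `ι_R` is `-1` on the diagonal and `0` elsewhere, so the flux group is topologically `G ^ N`. It
is therefore locally compact, and it inherits unimodularity from `G`, which makes its regular Haar
measure invariant under inversion. The left action is norm continuous because a function vanishing
at infinity is uniformly continuous for the right uniformity, in which a left translation moves all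
points by the same amount.

What remains is the theory of `L¹(K, A, α)` for a locally compact Hausdorff group `K` with
inversion-invariant Haar measure. Formally everything follows from Fubini, the substitutions `ρ ↦ τ
* ρ` and `ρ ↦ ρ⁻¹`, and the fact that each `α ρ` is an isometry.

The difficulty is that `K` is neither second countable nor σ-compact in general. The Haar measure
need not be σ-finite, and the Borel sets of `K × K` may exceed the product σ-algebra, so Fubini is
not available for arbitrary integrable functions. It is used only for continuous functions with
compact support, where it always holds, and the rest is reached by approximation. An integrable
function is dominated by a series of such functions with almost the same total integral; multiplying
two such series gives Young's inequality (`exists_conv_dominating`) through a measurable majorant.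
This yields absolute convergence, measurability of the convolution and the norm bound. Associativity
is checked on compactly supported continuous functions
(`twistedConvolution_assoc_of_hasCompactSupport`) and extends by density and continuity. -/

/-! ### Unimodularity -/

section Unimodular

open Measure Pointwise

open scoped NNReal ENNReal

/-- The modular character of a finite power of a unimodular group is trivial. -/
theorem modularCharacter_eq_one_of_continuousMulEquiv_pi {K G ι : Type*} [Group K]
    [TopologicalSpace K] [IsTopologicalGroup K] [LocallyCompactSpace K] [Group G]
    [TopologicalSpace G] [IsTopologicalGroup G] [T2Space G] [LocallyCompactSpace G] [Finite ι]
    (e : K ≃ₜ* (ι → G)) (hG : ∀ g : G, modularCharacter g = 1) (x : K) :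
    modularCharacter x = 1 := by
  classical
  cases nonempty_fintype ι
  suffices h : (modularCharacter : K →* ℝ≥0).comp e.symm.toMulEquiv.toMonoidHom = 1 by
    have hx : modularCharacter (e.symm (e x)) = 1 := DFunLike.congr_fun h (e x)
    rwa [e.symm_apply_apply] at hx
  -- The elements with a single nontrivial coordinate generate the finite power, so they suffice.
  refine MonoidHom.pi_ext fun i g => ?_
  set a : K := e.symm (Pi.mulSingle i g)
  change modularCharacterFun a = 1
  have hea : e a = Pi.mulSingle i g := by simp [a]
  borelize K G
  obtain ⟨C, hC, hC1⟩ := exists_compact_mem_nhds (1 : G)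
  -- A slab with compact cross-section in the directions other than `i`. It is stable under left and
  -- right translation along the `i`-th axis. Pushing the Haar measure of the slab to that axis
  -- produces a Haar measure of `G` without appeal to product measures.
  let B : Set K := {x | ∀ j, j ≠ i → e x j ∈ C}
  have hev : Continuous fun x : K => e x i := (continuous_apply i).comp e.continuous
  have hB : IsClosed B := by
    simp only [B, Set.ofPred_forall]
    exact isClosed_iInter fun j => isClosed_iInter fun _ =>
      hC.isClosed.preimage ((continuous_apply j).comp e.continuous)
  have hBmul : ∀ (h : G) (x : K), e.symm (Pi.mulSingle i h) * x ∈ B ↔ x ∈ B := fun h x =>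
    forall₂_congr fun j hj => by simp [Pi.mulSingle_eq_of_ne hj]
  have hmulB : ∀ x : K, x * a ∈ B ↔ x ∈ B := fun x =>
    forall₂_congr fun j hj => by simp [hea, Pi.mulSingle_eq_of_ne hj]
  let ν : Measure K := haar
  let p : Measure K → Measure G := fun m => (m.restrict B).map fun x => e x i
  have hp : ∀ (m : Measure K) (A : Set G), MeasurableSet A →
      p m A = m ((fun x => e x i) ⁻¹' A ∩ B) := fun m A hA => by
    simp only [p]
    rw [map_apply hev.measurable hA, restrict_apply (hev.measurable hA)]
  have hHaar : IsHaarMeasure (p ν) :=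
    { lt_top_of_isCompact := by
        intro A hA
        rw [hp ν A hA.measurableSet]
        have hc : IsCompact (e ⁻¹' (Set.univ.pi fun j => if j = i then A else C)) :=
          e.toHomeomorph.isCompact_preimage.2
            (isCompact_univ_pi fun j => by split_ifs <;> assumption)
        refine (measure_mono ?_).trans_lt hc.measure_lt_top
        rintro x ⟨hx, hxB⟩ j -
        by_cases hj : j = i
        · subst hj; simpa using hx
        · simpa [hj] using hxB j hj
      map_mul_left_eq_self := by
        intro h
        ext A hA
        rw [map_apply (measurable_const_mul h) hA, hp ν _ (measurable_const_mul h hA), hp ν A hA,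
          ← measure_preimage_mul ν (e.symm (Pi.mulSingle i h))
            ((fun x => e x i) ⁻¹' A ∩ B)]
        congr 1
        ext x
        simp only [Set.mem_inter_iff, Set.mem_preimage, hBmul]
        simp
      open_pos := by
        intro U hU ⟨y, hy⟩
        rw [hp ν U hU.measurableSet]
        let V : Set K := e ⁻¹' (Set.univ.pi fun j => if j = i then U else interior C)
        have hV : IsOpen V := (isOpen_set_pi Set.finite_univ fun j _ => by
          split_ifs
          · exact hU
          · exact isOpen_interior).preimage e.continuous
        have hVne : V.Nonempty := by
          refine ⟨e.symm (Pi.mulSingle i y), fun j _ => ?_⟩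
          by_cases hj : j = i
          · subst hj; simpa using hy
          · simpa [hj, Pi.mulSingle_eq_of_ne hj] using mem_interior_iff_mem_nhds.2 hC1
        have hVU : V ⊆ (fun x => e x i) ⁻¹' U ∩ B := by
          refine fun x hx => ⟨?_, ?_⟩
          · simpa using hx i trivial
          · intro j hj
            have := hx j trivial
            simp only [if_neg hj] at this
            exact interior_subset this
        exact ((hV.measure_pos ν hVne).trans_le (measure_mono hVU)).ne' }
  have : Regular (map (· * a) ν) := Regular.map (Homeomorph.mulRight a)
  have hsmul : map (· * a) ν = modularCharacterFun a • ν := by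
    rw [modularCharacterFun_eq_haarScalarFactor ν]
    exact isMulLeftInvariant_eq_smul_of_regular _ _
  -- Right translation by `a` preserves the slab and induces right translation by `g` on the axis.
  -- Hence the modular character of `K` at `a` equals that of `G` at `g`.
  have hpmap : map (· * g) (p ν) = modularCharacterFun a • p ν := by
    have h1 : p (modularCharacterFun a • ν) = modularCharacterFun a • p ν := by
      simp only [p]
      rw [restrict_smul, Measure.map_smul]
    rw [← h1, ← hsmul]
    ext A hA
    rw [map_apply (measurable_mul_const g) hA, hp _ _ (measurable_mul_const g hA), hp _ A hA,
      map_apply (measurable_mul_const a) ((hev.measurable hA).inter hB.measurableSet)]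
    congr 1
    ext x
    simp only [Set.mem_inter_iff, Set.mem_preimage, hmulB]
    simp [hea]
  have hg : modularCharacterFun g = 1 := hG g
  rw [modularCharacterFun_eq_haarScalarFactor (p ν)] at hg
  simp only [hpmap] at hg
  rw [haarScalarFactor_smul, haarScalarFactor_self] at hg
  simpa using hg

/-- A regular Haar measure on a unimodular group is invariant under inversion. -/
theorem isInvInvariant_of_modularCharacter_eq_one {K : Type*} [Group K] [TopologicalSpace K]
    [IsTopologicalGroup K] [LocallyCompactSpace K] [MeasurableSpace K] [BorelSpace K]
    (μ : Measure K) [μ.IsHaarMeasure] [μ.Regular] (hK : ∀ x : K, modularCharacter x = 1) :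
    μ.IsInvInvariant := by
  have : μ.IsMulRightInvariant := ⟨fun x => by
    have : Regular (map (· * x) μ) := Regular.map (Homeomorph.mulRight x)
    have h : modularCharacterFun x = 1 := hK x
    rw [modularCharacterFun_eq_haarScalarFactor μ] at h
    rw [isMulLeftInvariant_eq_smul_of_regular (map (· * x) μ) μ, h, one_smul]⟩
  have : Regular μ.inv := Regular.map (Homeomorph.inv K)
  constructor
  let c : ℝ≥0∞ := haarScalarFactor μ.inv μ
  have hc : μ.inv = c • μ := isMulLeftInvariant_eq_smul_of_regular μ.inv μ
  -- Right invariance of `μ` makes its inverse left invariant, hence a multiple `c • μ`. Inverting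
  -- twice gives `c ^ 2 = 1`, read off on a compact set of positive finite measure.
  have h2 : map Inv.inv (map Inv.inv μ) = c ^ 2 • μ := by
    rw [← inv_def μ, hc, Measure.map_smul, ← inv_def μ, hc, smul_smul, pow_two]
  have hμ : μ = c ^ 2 • μ := by
    rwa [map_map continuous_inv.measurable continuous_inv.measurable,
      Function.Involutive.comp_self inv_involutive, Measure.map_id] at h2
  obtain ⟨C⟩ : Nonempty (TopologicalSpace.PositiveCompacts K) := inferInstance
  have hc2 : c ^ 2 * μ C = 1 ^ 2 * μ C := by
    conv_rhs => rw [hμ]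
    simp
  have hc2 : c ^ 2 = 1 ^ 2 :=
    (ENNReal.mul_left_inj (measure_pos_of_nonempty_interior _ C.interior_nonempty).ne'
      C.isCompact.measure_lt_top.ne).1 hc2
  rw [hc, (ENNReal.pow_right_strictMono two_ne_zero).injective hc2, one_smul]

end Unimodular

/-! ### The flux group and its action under the simple surface intersection property -/

section FluxAction

variable {M : Type u} [TopologicalSpace M] {N : ℕ} {Γ : Graph M N}
  {S : Fin N → OrientedSurface M}

theorem iotaL_eq_zero (hS : SimpleSurfaceIntersectionProperty Γ S) (i j : Fin N) :
    iotaL (S j) (Γ.edge i) = 0 := by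
  have h : (Γ.edge i).source ∉ (S j).carrier := fun hs =>
    zero_ne_one ((hS.mem_iff i j 0).1 hs).2
  simp [iotaL, OutgoingIn, h]

theorem iotaR_eq (hS : SimpleSurfaceIntersectionProperty Γ S) (i j : Fin N) :
    iotaR (S j) (Γ.edge i) = if i = j then -1 else 0 := by
  split_ifs with hij
  · subst hij
    exact if_pos (hS.lies_above i)
  · have h : (Γ.edge i).target ∉ (S j).carrier := fun hs => hij ((hS.mem_iff i j 1).1 hs).1
    simp [iotaR, IngoingIn, h]

variable {G : Type v} [Group G]

/-- The flux through `S j` is nontrivial only in slot `j`, where its second component is arbitrary.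
Products of such fluxes fill all second components. -/
theorem mem_fluxGroup_iff (hS : SimpleSurfaceIntersectionProperty Γ S) (x : Fin N → G × G) :
    x ∈ fluxGroup G Γ S ↔ ∀ i, (x i).1 = 1 := by
  constructor
  · intro hx
    change x ∈ Submonoid.closure (fluxImages G Γ S) at hx
    induction hx using Submonoid.closure_induction with
    | mem x h =>
      obtain ⟨oL, oR, j, h⟩ := h
      intro i
      simp [h i, iotaL_eq_zero hS]
    | one => simp
    | mul x y _ _ hx hy => intro i; simp [hx i, hy i]
  · intro hx
    refine Subgroup.pi_mem_of_mulSingle_mem x fun j => ?_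
    -- The inverse compensates the exponent `-1` of an edge that ends on its surface from above.
    refine Submonoid.subset_closure ⟨1, fun _ => (x j).2⁻¹, j, fun i => ?_⟩
    rw [iotaL_eq_zero hS, iotaR_eq hS]
    by_cases hij : i = j
    · subst hij
      ext <;> simp [hx i]
    · simp [hij, Prod.one_eq_mk]

variable [TopologicalSpace G]

theorem continuous_ingoingFlux :
    Continuous (ingoingFlux : fluxGroup G Γ S → Fin N → G) := 
  continuous_pi fun i => continuous_snd.comp ((continuous_apply i).comp continuous_subtype_val)

/-- Under the simple surface intersection property the flux group is `G ^ N`. -/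
def ingoingFluxEquiv (G : Type v) [Group G] [TopologicalSpace G]
    (hS : SimpleSurfaceIntersectionProperty Γ S) : fluxGroup G Γ S ≃ₜ* (Fin N → G) where
  toFun := ingoingFlux
  invFun y := ⟨fun i => (1, y i), (mem_fluxGroup_iff hS _).2 fun _ => rfl⟩
  left_inv ρ := Subtype.ext <| funext fun i =>
    Prod.ext ((mem_fluxGroup_iff hS ρ.1).1 ρ.2 i).symm rfl
  right_inv _ := rfl
  map_mul' _ _ := rfl
  continuous_toFun := continuous_ingoingFlux
  continuous_invFun := by fun_prop

/-- Left translation of functions vanishing at infinity is norm continuous. -/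
theorem continuous_leftAction_apply [IsTopologicalGroup G] (f : C₀(configSpace G Γ, ℂ)) :
    Continuous fun ρ : fluxGroup G Γ S => leftAction Γ S ρ f := by
  -- In the right uniformity, the points `ρ₀⁻¹ x` and `ρ⁻¹ x` differ by `ρ⁻¹ ρ₀` whatever `x` is.
  -- Uniform continuity of `f` thus becomes uniform convergence.
  let : UniformSpace (Fin N → G) := IsTopologicalGroup.rightUniformSpace _
  have hf := ZeroAtInftyContinuousMap.uniformContinuous f
  rw [continuous_iff_continuousAt]
  intro ρ₀
  refine ZeroAtInftyContinuousMap.tendsto_iff_tendstoUniformly.2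
    (Metric.tendstoUniformly_iff.2 fun ε hε => ?_)
  have h := hf (Metric.dist_mem_uniformity hε)
  rw [Filter.mem_map, uniformity_subtype, Filter.mem_comap] at h
  obtain ⟨U, hU, hUf⟩ := h
  change U ∈ Filter.comap _ (𝓝 1) at hU
  obtain ⟨V, hV, hVU⟩ := hU
  have ht : Tendsto (fun ρ : fluxGroup G Γ S => (ingoingFlux ρ)⁻¹ * ingoingFlux ρ₀) (𝓝 ρ₀)
      (𝓝 1) := by
    have hc : Continuous fun ρ : fluxGroup G Γ S => (ingoingFlux ρ)⁻¹ * ingoingFlux ρ₀ :=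
      continuous_ingoingFlux.inv.mul continuous_const
    simpa using hc.tendsto ρ₀
  filter_upwards [ht hV] with ρ hρ x
  refine @hUf (leftTranslation Γ (ingoingFlux ρ₀)⁻¹ x, leftTranslation Γ (ingoingFlux ρ)⁻¹ x)
    (hVU ?_)
  simpa [leftTranslation, div_eq_mul_inv, mul_assoc] using hρ

end FluxAction

/-! ### Approximation by continuous functions with compact support -/

section Approximation

open scoped ENNReal

theorem ae_tendsto_zero_of_tsum_lintegral_ne_top {X : Type*} [MeasurableSpace X] {μ : Measure X}
    {D : ℕ → X → ℝ≥0∞} (hD : ∀ n, AEMeasurable (D n) μ) (h : ∑' n, ∫⁻ x, D n x ∂μ ≠ ∞) :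
    ∀ᵐ x ∂μ, Tendsto (fun n => D n x) atTop (𝓝 0) := by
  rw [← lintegral_tsum hD] at h
  filter_upwards [ae_lt_top' (AEMeasurable.tsum hD) h] with x hx
  exact ENNReal.tendsto_atTop_zero_of_tsum_ne_top hx.ne

theorem tendsto_of_enorm_sub_tendsto_zero {E : Type*} [NormedAddCommGroup E] {u : ℕ → E} {a : E}
    (h : Tendsto (fun n => ‖a - u n‖ₑ) atTop (𝓝 0)) : Tendsto u atTop (𝓝 a) := by
  rw [tendsto_iff_edist_tendsto_0]
  simpa only [edist_comm _ a, edist_eq_enorm_sub] using h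

/-- Errors with summable integrals tend to zero almost everywhere, so `f` is an a.e. limit of
measurable functions. The majorant `D` is needed because `‖f - g‖ₑ` is not yet known to be
measurable. -/
theorem aestronglyMeasurable_of_approx {X E : Type*} [MeasurableSpace X] {μ : Measure X}
    [NormedAddCommGroup E] {f : X → E}
    (h : ∀ ε : ℝ≥0∞, ε ≠ 0 → ∃ (g : X → E) (D : X → ℝ≥0∞), AEStronglyMeasurable g μ ∧
      AEMeasurable D μ ∧ (∀ᵐ x ∂μ, ‖f x - g x‖ₑ ≤ D x) ∧ ∫⁻ x, D x ∂μ ≤ ε) :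
    AEStronglyMeasurable f μ := by
  obtain ⟨δ, hδ, hδsum⟩ := ENNReal.exists_pos_sum_of_countable' one_ne_zero ℕ
  choose g D hg hD hgD hDδ using fun n => h (δ n) (hδ n).ne'
  refine aestronglyMeasurable_of_tendsto_ae atTop hg ?_
  have hsum : ∑' n, ∫⁻ x, D n x ∂μ ≠ ∞ :=
    ((ENNReal.tsum_le_tsum hDδ).trans_lt (hδsum.trans ENNReal.one_lt_top)).ne
  filter_upwards [ae_tendsto_zero_of_tsum_lintegral_ne_top hD hsum, ae_all_iff.2 hgD] with x hx hgx
  exact tendsto_of_enorm_sub_tendsto_zero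
    (tendsto_of_tendsto_of_tendsto_of_le_of_le tendsto_const_nhds hx (fun _ => zero_le) hgx)

/-- Indicator functions of sets of finite measure are approximated by continuous functions with
compact support. -/
theorem exists_hasCompactSupport_eLpNorm_sub_indicator_le {X E : Type*} [TopologicalSpace X]
    [T2Space X] [LocallyCompactSpace X] [MeasurableSpace X] [BorelSpace X] {μ : Measure X}
    [μ.Regular] [NormedAddCommGroup E] [NormedSpace ℝ E] (c : E) {t : Set X}
    (ht : MeasurableSet t) (hμt : μ t < ∞) {ε : ℝ≥0∞} (hε : ε ≠ 0) :
    ∃ g : X → E, eLpNorm (g - t.indicator fun _ => c) 1 μ ≤ ε ∧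
      (Continuous g ∧ HasCompactSupport g) := by
  obtain ⟨η, hη, hηε⟩ := exists_eLpNorm_indicator_le (μ := μ) ENNReal.one_ne_top c hε
  have hη2 : (η : ℝ≥0∞) / 2 ≠ 0 := (ENNReal.half_pos (ENNReal.coe_pos.2 hη).ne').ne'
  obtain ⟨s, hst, hs, hsc, hμs⟩ := ht.exists_isCompact_isClosed_sdiff_lt hμt.ne hη2
  obtain ⟨U, htU, hU, -, hμU⟩ := ht.exists_isOpen_sdiff_lt hμt.ne hη2
  obtain ⟨f, hfs, hfU, hfsupp, hf01⟩ := exists_continuous_one_zero_of_isCompact hs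
    hU.isClosed_compl (Set.disjoint_compl_right_iff_subset.2 (hst.trans htU))
  refine ⟨fun x => f x • c, ?_, by fun_prop, hfsupp.smul_right⟩
  -- With `s ⊆ t ⊆ U`, the error vanishes outside `U \ s` and is bounded there by `‖c‖`.
  refine (eLpNorm_mono fun x => ?_).trans (hηε (U \ s) ?_)
  · have hfc : ‖f x • c‖ ≤ ‖c‖ := by
      rw [norm_smul, Real.norm_of_nonneg (hf01 x).1]
      exact mul_le_of_le_one_left (norm_nonneg c) (hf01 x).2
    have hfc' : ‖f x • c - c‖ ≤ ‖c‖ := by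
      rw [← norm_neg, show -(f x • c - c) = (1 - f x) • c by rw [sub_smul, one_smul, neg_sub],
        norm_smul, Real.norm_of_nonneg (sub_nonneg.2 (hf01 x).2)]
      exact mul_le_of_le_one_left (norm_nonneg c) (by linarith [(hf01 x).1])
    by_cases hxs : x ∈ s
    · simp [hfs hxs, hst hxs, hxs]
    by_cases hxU : x ∈ U
    · by_cases hxt : x ∈ t
      · simpa [hxs, hxU, hxt] using hfc'
      · simpa [hxs, hxU, hxt] using hfc
    · have hxt : x ∉ t := fun h => hxU (htU h)
      simp [hfU hxU, hxt]
  · calc μ (U \ s) ≤ μ (U \ t ∪ t \ s) := measure_mono fun x hx => by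
          by_cases hxt : x ∈ t
          · exact Or.inr ⟨hxt, hx.2⟩
          · exact Or.inl ⟨hx.1, hxt⟩
      _ ≤ η / 2 + η / 2 := (measure_union_le _ _).trans (add_le_add hμU.le hμs.le)
      _ = η := ENNReal.add_halves _

/-- On a locally compact Hausdorff space with a regular measure, integrable functions are
approximated by continuous functions with compact support. -/
theorem exists_hasCompactSupport_lintegral_sub_le {X E : Type*} [TopologicalSpace X] [T2Space X]
    [LocallyCompactSpace X] [MeasurableSpace X] [BorelSpace X] {μ : Measure X} [μ.Regular]
    [NormedAddCommGroup E] [NormedSpace ℝ E] {F : X → E} (hF : Integrable F μ) {ε : ℝ≥0∞}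
    (hε : ε ≠ 0) :
    ∃ g : X → E, HasCompactSupport g ∧ ∫⁻ x, ‖F x - g x‖ₑ ∂μ ≤ ε ∧ Continuous g ∧
      Integrable g μ := by
  have hF' : MemLp F 1 μ := memLp_one_iff_integrable.2 hF
  have hadd : ∀ f g : X → E, Continuous f ∧ HasCompactSupport f →
      Continuous g ∧ HasCompactSupport g → Continuous (f + g) ∧ HasCompactSupport (f + g) := by
    rintro f g ⟨hf, hf'⟩ ⟨hg, hg'⟩
    exact ⟨hf.add hg, hf'.add hg'⟩
  have key := hF'.induction_dense ENNReal.one_ne_top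
    (fun g => Continuous g ∧ HasCompactSupport g) (fun c t ht hμt ε hε =>
      exists_hasCompactSupport_eLpNorm_sub_indicator_le c ht hμt hε)
    hadd
    (fun f hf => (hf.1.integrable_of_hasCompactSupport hf.2).aestronglyMeasurable) hε
  obtain ⟨g, hg, hgcont, hgsupp⟩ := key
  rw [eLpNorm_one_eq_lintegral_enorm] at hg
  exact ⟨g, hgsupp, hg, hgcont, hgcont.integrable_of_hasCompactSupport hgsupp⟩

/-- An integrable function is dominated by a series of continuous functions with compact support
that has nearly the same integral. -/
theorem exists_hasCompactSupport_tsum_dominating {X E : Type*} [TopologicalSpace X] [T2Space X]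
    [LocallyCompactSpace X] [MeasurableSpace X] [BorelSpace X] {μ : Measure X} [μ.Regular]
    [NormedAddCommGroup E] [NormedSpace ℝ E] {F : X → E} (hF : Integrable F μ) {ε : ℝ≥0∞}
    (hε : ε ≠ 0) :
    ∃ u : ℕ → X → E, (∀ n, Continuous (u n)) ∧ (∀ n, HasCompactSupport (u n)) ∧
      (∀ᵐ x ∂μ, ‖F x‖ₑ ≤ ∑' n, ‖u n x‖ₑ) ∧
      ∑' n, ∫⁻ x, ‖u n x‖ₑ ∂μ ≤ ∫⁻ x, ‖F x‖ₑ ∂μ + ε := by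
  obtain ⟨δ, hδ, hδsum⟩ := ENNReal.exists_pos_sum_of_countable' (ENNReal.half_pos hε).ne' ℕ
  choose g hgsupp hgδ hgcont hgint using fun n =>
    exists_hasCompactSupport_lintegral_sub_le hF (hδ n).ne'
  have hD : ∀ n, AEMeasurable (fun x => ‖F x - g n x‖ₑ) μ := fun n =>
    (hF.aestronglyMeasurable.sub (hgint n).aestronglyMeasurable).enorm
  -- Telescoping differences of approximants with errors at most `δ n`. The integrals of `‖u n‖`
  -- then add up to at most that of `‖F‖` plus twice the sum of the `δ n`, which is why the `δ n`
  -- sum to less than `ε / 2`.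
  let u : ℕ → X → E := fun n => Nat.casesOn n (g 0) fun n => g (n + 1) - g n
  have hsum : ∀ n x, ∑ k ∈ Finset.range (n + 1), u k x = g n x := by
    intro n x
    rw [Finset.sum_range_succ', ← eq_sub_iff_add_eq]
    exact Finset.sum_range_sub (fun k => g k x) n
  refine ⟨u, ?_, ?_, ?_, ?_⟩
  · rintro (_ | n)
    exacts [hgcont 0, (hgcont _).sub (hgcont _)]
  · rintro (_ | n)
    exacts [hgsupp 0, (hgsupp _).sub (hgsupp _)]
  · have hsum' : ∑' n, ∫⁻ x, ‖F x - g n x‖ₑ ∂μ ≠ ∞ :=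
      ((ENNReal.tsum_le_tsum hgδ).trans_lt (hδsum.trans_le le_top)).ne
    filter_upwards [ae_tendsto_zero_of_tsum_lintegral_ne_top hD hsum'] with x hx
    refine le_of_tendsto (tendsto_of_enorm_sub_tendsto_zero hx).enorm
      (Eventually.of_forall fun n => ?_)
    rw [← hsum n x]
    exact (enorm_sum_le _ _).trans (ENNReal.sum_le_tsum _)
  · have h0 : ∫⁻ x, ‖u 0 x‖ₑ ∂μ ≤ ∫⁻ x, ‖F x‖ₑ ∂μ + δ 0 := by
      have h : ∀ x, ‖u 0 x‖ₑ ≤ ‖F x‖ₑ + ‖F x - g 0 x‖ₑ := fun x => by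
        have h := enorm_sub_le (a := F x) (b := F x - g 0 x)
        rwa [sub_sub_cancel] at h
      refine (lintegral_mono h).trans ?_
      rw [lintegral_add_left' hF.aestronglyMeasurable.enorm]
      gcongr
      exact hgδ 0
    have h1 : ∀ n, ∫⁻ x, ‖u (n + 1) x‖ₑ ∂μ ≤ δ n + δ (n + 1) := by
      intro n
      have h : ∀ x, ‖u (n + 1) x‖ₑ ≤ ‖F x - g n x‖ₑ + ‖F x - g (n + 1) x‖ₑ := fun x => by
        have h := enorm_sub_le (a := F x - g n x) (b := F x - g (n + 1) x)
        rwa [sub_sub_sub_cancel_left] at h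
      refine (lintegral_mono h).trans ?_
      rw [lintegral_add_left' (hD n)]
      exact add_le_add (hgδ n) (hgδ (n + 1))
    rw [tsum_eq_zero_add' ENNReal.summable]
    calc ∫⁻ x, ‖u 0 x‖ₑ ∂μ + ∑' n, ∫⁻ x, ‖u (n + 1) x‖ₑ ∂μ
        ≤ (∫⁻ x, ‖F x‖ₑ ∂μ + δ 0) + ∑' n, (δ n + δ (n + 1)) :=
          add_le_add h0 (ENNReal.tsum_le_tsum h1)
      _ = ∫⁻ x, ‖F x‖ₑ ∂μ + (∑' n, δ n + (δ 0 + ∑' n, δ (n + 1))) := by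
          rw [ENNReal.tsum_add]; ring
      _ = ∫⁻ x, ‖F x‖ₑ ∂μ + (∑' n, δ n + ∑' n, δ n) := by
          rw [← tsum_eq_zero_add' (f := δ) ENNReal.summable]
      _ ≤ ∫⁻ x, ‖F x‖ₑ ∂μ + (ε / 2 + ε / 2) := by gcongr
      _ = ∫⁻ x, ‖F x‖ₑ ∂μ + ε := by rw [ENNReal.add_halves]

end Approximation

/-! ### Absolute convergence of convolutions -/

section Convolution

open scoped ENNReal Pointwise

theorem mem_tsupport_of_conv_ne_zero {K E E' : Type*} [Group K] [TopologicalSpace K]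
    [Zero E] [Zero E'] {u : K → E} {v : K → E'} {ρ τ : K}
    (hu : u ρ ≠ 0) (hv : v (ρ⁻¹ * τ) ≠ 0) : ρ ∈ tsupport u ∧ τ ∈ tsupport u * tsupport v :=
  ⟨subset_tsupport _ hu, ρ, subset_tsupport _ hu, ρ⁻¹ * τ, subset_tsupport _ hv, by simp⟩

variable {K : Type*} [Group K] [TopologicalSpace K] [IsTopologicalGroup K]
  [MeasurableSpace K] [BorelSpace K] {μ : Measure K}
  {E E' : Type*} [NormedAddCommGroup E] [NormedAddCommGroup E']

/-- The map is the left translation by `τ⁻¹` followed by inversion. -/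
theorem measurePreserving_inv_mul [μ.IsMulLeftInvariant] [μ.IsInvInvariant] (τ : K) :
    MeasurePreserving (fun ρ => ρ⁻¹ * τ) μ μ := by
  have h := (Measure.measurePreserving_inv μ).comp (measurePreserving_mul_left μ τ⁻¹)
  convert h using 1
  ext ρ
  simp

theorem integrable_comp_inv_mul [μ.IsMulLeftInvariant] [μ.IsInvInvariant] {H : K → E}
    (hH : Integrable H μ) (τ : K) : Integrable (fun ρ => H (ρ⁻¹ * τ)) μ :=
  (measurePreserving_inv_mul τ).integrable_comp_of_integrable hH

/-- Continuity and compact support of an integral that depends on a parameter. -/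
theorem continuous_hasCompactSupport_integral [IsFiniteMeasureOnCompacts μ] [NormedSpace ℝ E]
    {f : K → K → E} (hf : Continuous f.uncurry) {k l : Set K} (hk : IsCompact k) (hl : IsCompact l)
    (h : ∀ x y, f x y ≠ 0 → y ∈ k ∧ x ∈ l) :
    Continuous (fun x => ∫ y, f x y ∂μ) ∧ HasCompactSupport (fun x => ∫ y, f x y ∂μ) := by
  constructor
  · rw [← continuousOn_univ]
    exact continuousOn_integral_of_compact_support hk hf.continuousOn fun x y _ hy =>
      by_contra fun hne => hy (h x y hne).1
  · refine HasCompactSupport.intro hl fun x hx => ?_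
    have h0 : ∀ y, f x y = 0 := fun y => by_contra fun hne => hx (h x y hne).2
    simp [h0]

/-- Tonelli's theorem for the convolution of continuous functions with compact support. -/
theorem lintegral_lintegral_conv [T2Space K] [LocallyCompactSpace K]
    [μ.IsHaarMeasure] {u : K → E} {v : K → E'} (hu : Continuous u) (hu' : HasCompactSupport u) (hv : Continuous v) (hv' : HasCompactSupport v) :
    Measurable (fun τ => ∫⁻ ρ, ‖u ρ‖ₑ * ‖v (ρ⁻¹ * τ)‖ₑ ∂μ) ∧
      ∫⁻ τ, ∫⁻ ρ, ‖u ρ‖ₑ * ‖v (ρ⁻¹ * τ)‖ₑ ∂μ ∂μ = (∫⁻ ρ, ‖u ρ‖ₑ ∂μ) * ∫⁻ ρ, ‖v ρ‖ₑ ∂μ := by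
  -- The passage to real integrals allows Fubini for continuous functions with compact support,
  -- which needs no σ-finiteness.
  let Φ : K → K → ℝ := fun τ ρ => ‖u ρ‖ * ‖v (ρ⁻¹ * τ)‖
  have hΦ : Continuous Φ.uncurry := by
    simp only [Φ, Function.uncurry_def]
    fun_prop
  have hΦ0 : ∀ τ ρ, 0 ≤ Φ τ ρ := fun τ ρ => by positivity
  have hsupp : ∀ τ ρ, Φ τ ρ ≠ 0 → ρ ∈ tsupport u ∧ τ ∈ tsupport u * tsupport v := fun τ ρ h =>
    mem_tsupport_of_conv_ne_zero (norm_ne_zero_iff.1 (left_ne_zero_of_mul h))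
      (norm_ne_zero_iff.1 (right_ne_zero_of_mul h))
  have hl : IsCompact (tsupport u * tsupport v) := hu'.isCompact.mul hv'.isCompact
  obtain ⟨hc, hs⟩ := continuous_hasCompactSupport_integral (μ := μ) hΦ hu'.isCompact hl hsupp
  have hint : ∀ τ, Integrable (Φ τ) μ := fun τ =>
    (hΦ.comp (Continuous.prodMk_right τ)).integrable_of_hasCompactSupport
      (HasCompactSupport.intro hu'.isCompact fun ρ hρ =>
        by_contra fun hne => hρ (hsupp τ ρ hne).1)
  have hin : ∀ τ, ∫⁻ ρ, ‖u ρ‖ₑ * ‖v (ρ⁻¹ * τ)‖ₑ ∂μ = ENNReal.ofReal (∫ ρ, Φ τ ρ ∂μ) := by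
    intro τ
    rw [ofReal_integral_eq_lintegral_ofReal (hint τ) (Eventually.of_forall (hΦ0 τ))]
    simp only [Φ, ENNReal.ofReal_mul (norm_nonneg _), ofReal_norm]
  simp only [hin]
  refine ⟨hc.measurable.ennreal_ofReal, ?_⟩
  rw [← ofReal_integral_eq_lintegral_ofReal (hc.integrable_of_hasCompactSupport hs)
    (Eventually.of_forall fun τ => integral_nonneg (hΦ0 τ)),
    integral_integral_swap_of_hasCompactSupport hΦ
      (HasCompactSupport.intro (hl.prod hu'.isCompact) fun x hx =>
        by_contra fun hne => hx (hsupp x.1 x.2 hne).symm)]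
  have hout : ∀ ρ, ∫ τ, Φ τ ρ ∂μ = ‖u ρ‖ * ∫ τ, ‖v τ‖ ∂μ := fun ρ => by
    simp only [Φ]
    rw [integral_const_mul, integral_mul_left_eq_self (fun τ => ‖v τ‖) ρ⁻¹]
  simp only [hout]
  rw [integral_mul_const, ENNReal.ofReal_mul (integral_nonneg fun _ => norm_nonneg _),
    ofReal_integral_norm_eq_lintegral_enorm (hu.integrable_of_hasCompactSupport hu'),
    ofReal_integral_norm_eq_lintegral_enorm (hv.integrable_of_hasCompactSupport hv')]

/-- Young's inequality for integrable functions on a unimodular group, in a form that does not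
require the integrand to be measurable on the product. -/
theorem exists_conv_dominating [T2Space K] [LocallyCompactSpace K] [μ.IsHaarMeasure] [μ.Regular] [μ.IsInvInvariant] [NormedSpace ℝ E]
    [NormedSpace ℝ E'] {F : K → E} {H : K → E'} (hF : Integrable F μ) (hH : Integrable H μ)
    {ε : ℝ≥0∞} (hε : ε ≠ 0) :
    ∃ D : K → ℝ≥0∞, Measurable D ∧ (∀ τ, ∫⁻ ρ, ‖F ρ‖ₑ * ‖H (ρ⁻¹ * τ)‖ₑ ∂μ ≤ D τ) ∧
      ∫⁻ τ, D τ ∂μ ≤ (∫⁻ ρ, ‖F ρ‖ₑ ∂μ + ε) * (∫⁻ ρ, ‖H ρ‖ₑ ∂μ + ε) := by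
  obtain ⟨u, hu, hu', hFu, hus⟩ := exists_hasCompactSupport_tsum_dominating hF hε
  obtain ⟨v, hv, hv', hHv, hvs⟩ := exists_hasCompactSupport_tsum_dominating hH hε
  have hT := fun n m => lintegral_lintegral_conv (μ := μ) (hu n) (hu' n) (hv m) (hv' m)
  -- The majorant is the double series of convolutions of the pieces. It bounds the convolution at
  -- every `τ`, since `ρ ↦ ρ⁻¹ * τ` pulls null sets back to null sets.
  refine ⟨fun τ => ∑' n, ∑' m, ∫⁻ ρ, ‖u n ρ‖ₑ * ‖v m (ρ⁻¹ * τ)‖ₑ ∂μ,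
    Measurable.tsum fun n => Measurable.tsum fun m => (hT n m).1, fun τ => ?_, ?_⟩
  · have hm : ∀ n m, Measurable fun ρ => ‖u n ρ‖ₑ * ‖v m (ρ⁻¹ * τ)‖ₑ := fun n m =>
      (hu n).enorm.measurable.mul
        ((hv m).comp (continuous_inv.mul continuous_const)).enorm.measurable
    have hsum : ∑' n, ∑' m, ∫⁻ ρ, ‖u n ρ‖ₑ * ‖v m (ρ⁻¹ * τ)‖ₑ ∂μ =
        ∫⁻ ρ, (∑' n, ‖u n ρ‖ₑ) * ∑' m, ‖v m (ρ⁻¹ * τ)‖ₑ ∂μ := by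
      have hprod : ∀ ρ, (∑' n, ‖u n ρ‖ₑ) * ∑' m, ‖v m (ρ⁻¹ * τ)‖ₑ =
          ∑' n, ∑' m, ‖u n ρ‖ₑ * ‖v m (ρ⁻¹ * τ)‖ₑ := fun ρ => by
        simp only [ENNReal.tsum_mul_left, ENNReal.tsum_mul_right]
      simp only [hprod]
      rw [lintegral_tsum fun n => (Measurable.tsum fun m => hm n m).aemeasurable]
      exact tsum_congr fun n => (lintegral_tsum fun m => (hm n m).aemeasurable).symm
    refine (lintegral_mono_ae ?_).trans_eq hsum.symm
    filter_upwards [hFu, (measurePreserving_inv_mul τ).quasiMeasurePreserving.ae hHv] with ρ h1 h2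
    exact mul_le_mul' h1 h2
  · rw [lintegral_tsum fun n => (Measurable.tsum fun m => (hT n m).1).aemeasurable]
    calc ∑' n, ∫⁻ τ, ∑' m, ∫⁻ ρ, ‖u n ρ‖ₑ * ‖v m (ρ⁻¹ * τ)‖ₑ ∂μ ∂μ
        = ∑' n, ∑' m, (∫⁻ ρ, ‖u n ρ‖ₑ ∂μ) * ∫⁻ ρ, ‖v m ρ‖ₑ ∂μ := tsum_congr fun n => by
          rw [lintegral_tsum fun m => (hT n m).1.aemeasurable]
          exact tsum_congr fun m => (hT n m).2
      _ = (∑' n, ∫⁻ ρ, ‖u n ρ‖ₑ ∂μ) * ∑' m, ∫⁻ ρ, ‖v m ρ‖ₑ ∂μ := by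
          simp only [ENNReal.tsum_mul_left, ENNReal.tsum_mul_right]
      _ ≤ _ := mul_le_mul' hus hvs

end Convolution

/-! ### Twisted convolution and involution of functions -/

section TwistedConvolution

open scoped ENNReal Pointwise

variable {K : Type*} [Group K] {A : Type*} [NonUnitalCStarAlgebra A] {α : K →* (A ≃⋆ₐ[ℂ] A)}

theorem norm_action_apply (α : K →* (A ≃⋆ₐ[ℂ] A)) (ρ : K) (a : A) : ‖α ρ a‖ = ‖a‖ :=
  NonUnitalStarAlgHom.norm_map (α ρ) (α ρ).injective a

theorem enorm_action_apply (α : K →* (A ≃⋆ₐ[ℂ] A)) (ρ : K) (a : A) : ‖α ρ a‖ₑ = ‖a‖ₑ := by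
  rw [← ofReal_norm, norm_action_apply, ofReal_norm]

theorem action_mul_apply (α : K →* (A ≃⋆ₐ[ℂ] A)) (ρ τ : K) (a : A) :
    α (ρ * τ) a = α ρ (α τ a) := by
  rw [map_mul]; rfl

/-- The action of a group element as a real linear isometry. -/
def actionIsometry (α : K →* (A ≃⋆ₐ[ℂ] A)) (ρ : K) : A →ₗᵢ[ℝ] A where
  toFun := α ρ
  map_add' := map_add (α ρ)
  map_smul' c a := by
    have h := map_smul (α ρ) (c : ℂ) a
    simpa using h
  norm_map' := norm_action_apply α ρ

/-- No integrability is required: an isometry preserves integrability in both directions, and the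
default value `0` is fixed. -/
theorem action_integral {X : Type*} [MeasurableSpace X] (α : K →* (A ≃⋆ₐ[ℂ] A)) (ρ : K)
    (μ : Measure X) (f : X → A) : α ρ (∫ x, f x ∂μ) = ∫ x, α ρ (f x) ∂μ :=
  ((actionIsometry α ρ).integral_comp_comm f).symm

theorem star_integral {X : Type*} [MeasurableSpace X] (μ : Measure X) (f : X → A) :
    star (∫ x, f x ∂μ) = ∫ x, star (f x) ∂μ :=
  ((starL' ℝ : A ≃L[ℝ] A).integral_comp_comm f).symm

theorem twistedInvolution_twistedInvolution (F : K → A) :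
    twistedInvolution α (twistedInvolution α F) = F := by
  ext ρ
  simp only [twistedInvolution, inv_inv]
  rw [← map_star, star_star, ← action_mul_apply, mul_inv_cancel, map_one]
  rfl

theorem twistedConvolution_smul_left [MeasurableSpace K] (μ : Measure K) (c : ℂ) (F H : K → A) :
    twistedConvolution α μ (c • F) H = c • twistedConvolution α μ F H := by
  ext τ
  simp only [twistedConvolution, Pi.smul_apply, smul_mul_assoc, integral_smul]

theorem twistedConvolution_smul_right [MeasurableSpace K] (μ : Measure K) (c : ℂ) (F H : K → A) :
    twistedConvolution α μ F (c • H) = c • twistedConvolution α μ F H := by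
  ext τ
  simp only [twistedConvolution, Pi.smul_apply, map_smul, mul_smul_comm, integral_smul]

theorem lintegral_enorm_twistedConvolution_integrand_le [MeasurableSpace K] {μ : Measure K}
    (F H : K → A) (τ : K) :
    ∫⁻ ρ, ‖F ρ * α ρ (H (ρ⁻¹ * τ))‖ₑ ∂μ ≤ ∫⁻ ρ, ‖F ρ‖ₑ * ‖H (ρ⁻¹ * τ)‖ₑ ∂μ := by
  refine lintegral_mono fun ρ => ?_
  rw [← enorm_action_apply α ρ (H (ρ⁻¹ * τ)), ← ofReal_norm, ← ofReal_norm, ← ofReal_norm,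
    ← ENNReal.ofReal_mul (norm_nonneg _)]
  exact ENNReal.ofReal_le_ofReal (norm_mul_le _ _)

theorem enorm_twistedConvolution_le [MeasurableSpace K] {μ : Measure K} (F H : K → A) (τ : K) :
    ‖twistedConvolution α μ F H τ‖ₑ ≤ ∫⁻ ρ, ‖F ρ‖ₑ * ‖H (ρ⁻¹ * τ)‖ₑ ∂μ :=
  (enorm_integral_le_lintegral_enorm _).trans
    (lintegral_enorm_twistedConvolution_integrand_le F H τ)

variable [TopologicalSpace K]

/-- Point-norm continuity becomes joint continuity because all `α ρ` are isometries. -/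
theorem HolonomyFlux.IsCStarDynamicalSystem.continuous_uncurry (hα : IsCStarDynamicalSystem α) :
    Continuous fun p : K × A => α p.1 p.2 := by
  rw [continuous_iff_continuousAt]
  rintro ⟨ρ₀, a₀⟩
  rw [ContinuousAt, tendsto_iff_norm_sub_tendsto_zero]
  have h1 : Tendsto (fun p : K × A => ‖p.2 - a₀‖ + ‖α p.1 a₀ - α ρ₀ a₀‖) (𝓝 (ρ₀, a₀)) (𝓝 0) := by
    have hc : Continuous fun p : K × A => ‖p.2 - a₀‖ + ‖α p.1 a₀ - α ρ₀ a₀‖ :=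
      (continuous_snd.sub continuous_const).norm.add
        (((hα.continuous_apply a₀).comp continuous_fst).sub continuous_const).norm
    simpa using hc.tendsto (ρ₀, a₀)
  refine squeeze_zero (fun _ => norm_nonneg _) (fun p => ?_) h1
  calc ‖α p.1 p.2 - α ρ₀ a₀‖ = ‖α p.1 (p.2 - a₀) + (α p.1 a₀ - α ρ₀ a₀)‖ := by
        rw [map_sub]; abel_nf
    _ ≤ ‖α p.1 (p.2 - a₀)‖ + ‖α p.1 a₀ - α ρ₀ a₀‖ := norm_add_le _ _
    _ = ‖p.2 - a₀‖ + ‖α p.1 a₀ - α ρ₀ a₀‖ := by rw [norm_action_apply]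

theorem HolonomyFlux.IsCStarDynamicalSystem.continuous_comp (hα : IsCStarDynamicalSystem α)
    {X : Type*} [TopologicalSpace X] {f : X → K} {g : X → A} (hf : Continuous f)
    (hg : Continuous g) : Continuous fun x => α (f x) (g x) :=
  hα.continuous_uncurry.comp (hf.prodMk hg)

theorem mem_tsupport_of_twistedConvolution_integrand_ne_zero {F H : K → A} {τ ρ : K}
    (h : F ρ * α ρ (H (ρ⁻¹ * τ)) ≠ 0) : ρ ∈ tsupport F ∧ τ ∈ tsupport F * tsupport H :=
  mem_tsupport_of_conv_ne_zero (left_ne_zero_of_mul h) fun h0 => h (by rw [h0, map_zero, mul_zero])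

theorem continuous_twistedConvolution_integrand [IsTopologicalGroup K]
    (hα : IsCStarDynamicalSystem α) {F H : K → A} (hF : Continuous F) (hH : Continuous H) :
    Continuous (Function.uncurry fun τ ρ : K => F ρ * α ρ (H (ρ⁻¹ * τ))) :=
  (hF.comp continuous_snd).mul (hα.continuous_comp continuous_snd
    (hH.comp (continuous_snd.inv.mul continuous_fst)))

/-- Only measurability is at stake. Joint continuity gives it for continuous functions with compact
support, and applying `α ρ` does not change the approximation error. -/
theorem integrable_action [T2Space K] [LocallyCompactSpace K] [MeasurableSpace K] [BorelSpace K]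
    {μ : Measure K} [μ.Regular] (hα : IsCStarDynamicalSystem α) {H : K → A} (hH : Integrable H μ) : Integrable (fun ρ => α ρ (H ρ)) μ := by
  refine ⟨aestronglyMeasurable_of_approx fun ε hε => ?_, ?_⟩
  · obtain ⟨g, hg, hgε, hgc, hgi⟩ := exists_hasCompactSupport_lintegral_sub_le hH hε
    have hc : Continuous fun ρ => α ρ (g ρ) := hα.continuous_comp continuous_id hgc
    have hs : HasCompactSupport fun ρ => α ρ (g ρ) :=
      hg.mono fun ρ hρ h0 => hρ (by simp only [h0, map_zero])
    refine ⟨fun ρ => α ρ (g ρ), fun ρ => ‖H ρ - g ρ‖ₑ,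
      (hc.integrable_of_hasCompactSupport hs).aestronglyMeasurable,
      (hH.sub hgi).aestronglyMeasurable.enorm, Eventually.of_forall fun ρ => ?_, hgε⟩
    rw [← map_sub, enorm_action_apply]
  · simpa only [HasFiniteIntegral, enorm_action_apply] using hH.hasFiniteIntegral

variable [IsTopologicalGroup K] [MeasurableSpace K] [BorelSpace K] {μ : Measure K}

theorem twistedConvolution_congr [μ.IsMulLeftInvariant] [μ.IsInvInvariant] {F F' H H' : K → A}
    (hF : F =ᵐ[μ] F') (hH : H =ᵐ[μ] H') :
    twistedConvolution α μ F H = twistedConvolution α μ F' H' := by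
  ext τ
  refine integral_congr_ae ?_
  filter_upwards [hF, (measurePreserving_inv_mul τ).quasiMeasurePreserving.ae hH] with ρ h1 h2
  rw [h1, h2]

theorem twistedInvolution_congr [μ.IsInvInvariant] {F F' : K → A} (hF : F =ᵐ[μ] F') :
    twistedInvolution α F =ᵐ[μ] twistedInvolution α F' := by
  filter_upwards [(Measure.measurePreserving_inv μ).quasiMeasurePreserving.ae hF] with ρ h
  simp only [twistedInvolution, h]

/-- Here unimodularity enters: the involution is isometric without a modular factor. -/
theorem lintegral_enorm_twistedInvolution [μ.IsInvInvariant] (F : K → A) :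
    ∫⁻ ρ, ‖twistedInvolution α F ρ‖ₑ ∂μ = ∫⁻ ρ, ‖F ρ‖ₑ ∂μ := by
  simp only [twistedInvolution, enorm_action_apply]
  rw [← lintegral_inv_eq_self (fun ρ => ‖F ρ‖ₑ)]
  simp [← ofReal_norm]

/-- The involution is an antihomomorphism for the twisted convolution. -/
theorem twistedInvolution_twistedConvolution [μ.IsMulLeftInvariant] (F H : K → A) :
    twistedInvolution α (twistedConvolution α μ F H) =
      twistedConvolution α μ (twistedInvolution α H) (twistedInvolution α F) := by
  ext τ
  simp only [twistedInvolution, twistedConvolution]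
  rw [star_integral, action_integral]
  -- After the substitution `ρ ↦ τ * ρ` the two integrands agree pointwise, so the identity holds at
  -- every `τ`, convergent or not.
  conv_rhs => rw [← integral_mul_left_eq_self _ τ]
  refine integral_congr_ae (Eventually.of_forall fun ρ => ?_)
  have h1 : ((τ * ρ)⁻¹ * τ)⁻¹ = ρ := by group
  have h2 : τ * ρ * ((τ * ρ)⁻¹ * τ) = τ := by group
  simp only [← action_mul_apply, h1, h2]
  rw [star_mul, ← map_star, map_mul, ← action_mul_apply, mul_inv_rev]

theorem continuous_hasCompactSupport_twistedConvolution [IsFiniteMeasureOnCompacts μ]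
    (hα : IsCStarDynamicalSystem α) {F H : K → A} (hF : Continuous F) (hF' : HasCompactSupport F)
    (hH : Continuous H) (hH' : HasCompactSupport H) :
    Continuous (twistedConvolution α μ F H) ∧ HasCompactSupport (twistedConvolution α μ F H) :=
  continuous_hasCompactSupport_integral (continuous_twistedConvolution_integrand hα hF hH)
    hF'.isCompact (hF'.isCompact.mul hH'.isCompact)
    fun _ _ => mem_tsupport_of_twistedConvolution_integrand_ne_zero

theorem integrable_twistedConvolution_integrand_of_hasCompactSupport
    [IsFiniteMeasureOnCompacts μ] (hα : IsCStarDynamicalSystem α) {F H : K → A}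
    (hF : Continuous F) (hF' : HasCompactSupport F) (hH : Continuous H) (τ : K) :
    Integrable (fun ρ => F ρ * α ρ (H (ρ⁻¹ * τ))) μ :=
  ((continuous_twistedConvolution_integrand hα hF hH).comp
    (Continuous.prodMk_right τ)).integrable_of_hasCompactSupport hF'.mul_right

/-- Associativity of the twisted convolution of continuous functions with compact support. -/
theorem twistedConvolution_assoc_of_hasCompactSupport [μ.IsHaarMeasure]
    (hα : IsCStarDynamicalSystem α) {F H L : K → A} (hF : Continuous F)
    (hF' : HasCompactSupport F) (hH : Continuous H) (hH' : HasCompactSupport H)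
    (hL : Continuous L) :
    twistedConvolution α μ (twistedConvolution α μ F H) L =
      twistedConvolution α μ F (twistedConvolution α μ H L) := by
  ext τ
  -- Both sides are iterated integrals of this kernel. The factors with `F` and `H` alone confine
  -- `(σ, ρ)` to a compact set.
  let Φ : K → K → A := fun σ ρ => F ρ * α ρ (H (ρ⁻¹ * σ)) * α σ (L (σ⁻¹ * τ))
  have hΦ : Continuous Φ.uncurry := by
    refine (continuous_twistedConvolution_integrand hα hF hH).mul
      (hα.continuous_comp continuous_fst (hL.comp ?_))
    fun_prop
  have hΦs : HasCompactSupport Φ.uncurry :=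
    HasCompactSupport.intro ((hF'.isCompact.mul hH'.isCompact).prod hF'.isCompact) fun x hx =>
      by_contra fun hne => hx
        (mem_tsupport_of_twistedConvolution_integrand_ne_zero (left_ne_zero_of_mul hne)).symm
  have hleft : ∀ σ, twistedConvolution α μ F H σ * α σ (L (σ⁻¹ * τ)) = ∫ ρ, Φ σ ρ ∂μ := fun σ =>
    (((ContinuousLinearMap.mul ℝ A).flip (α σ (L (σ⁻¹ * τ)))).integral_comp_comm
      (integrable_twistedConvolution_integrand_of_hasCompactSupport hα hF hF' hH σ)).symm
  have hright : ∀ ρ, ∫ σ, Φ σ ρ ∂μ = F ρ * α ρ (twistedConvolution α μ H L (ρ⁻¹ * τ)) := by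
    intro ρ
    have hint : Integrable (fun σ => α ρ (H σ * α σ (L (σ⁻¹ * (ρ⁻¹ * τ))))) μ :=
      (actionIsometry α ρ).toContinuousLinearMap.integrable_comp
        (integrable_twistedConvolution_integrand_of_hasCompactSupport hα hH hH' hL (ρ⁻¹ * τ))
    rw [twistedConvolution, action_integral]
    refine Eq.trans ?_ ((ContinuousLinearMap.mul ℝ A (F ρ)).integral_comp_comm hint)
    -- The substitution `σ ↦ ρ * σ` turns `H (ρ⁻¹ * σ)` into `H σ` and splits `α (ρ * σ)` as `α ρ`
    -- after `α σ`.
    rw [← integral_mul_left_eq_self _ ρ]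
    refine integral_congr_ae (Eventually.of_forall fun σ => ?_)
    simp only [Φ, ContinuousLinearMap.mul_apply', map_mul (α ρ), mul_assoc, inv_mul_cancel_left,
      action_mul_apply, mul_inv_rev]
  calc twistedConvolution α μ (twistedConvolution α μ F H) L τ
      = ∫ σ, ∫ ρ, Φ σ ρ ∂μ ∂μ := integral_congr_ae (Eventually.of_forall hleft)
    _ = ∫ ρ, ∫ σ, Φ σ ρ ∂μ ∂μ := integral_integral_swap_of_hasCompactSupport hΦ hΦs
    _ = _ := integral_congr_ae (Eventually.of_forall hright)

variable [T2Space K] [LocallyCompactSpace K]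

theorem integrable_twistedInvolution [μ.Regular] [μ.IsInvInvariant]
    (hα : IsCStarDynamicalSystem α) {F : K → A} (hF : Integrable F μ) :
    Integrable (twistedInvolution α F) μ :=
  integrable_action hα ((starL' ℝ : A ≃L[ℝ] A).integrable_comp_iff.2 hF.comp_inv)

theorem aestronglyMeasurable_twistedConvolution_integrand [μ.Regular] [μ.IsMulLeftInvariant]
    [μ.IsInvInvariant] (hα : IsCStarDynamicalSystem α) {F H : K → A} (hF : Integrable F μ)
    (hH : Integrable H μ) (τ : K) :
    AEStronglyMeasurable (fun ρ => F ρ * α ρ (H (ρ⁻¹ * τ))) μ :=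
  hF.aestronglyMeasurable.mul
    (integrable_action hα (integrable_comp_inv_mul hH τ)).aestronglyMeasurable

/-- The twisted convolution of integrable functions converges absolutely almost everywhere. -/
theorem ae_integrable_twistedConvolution_integrand [μ.IsHaarMeasure] [μ.Regular]
    [μ.IsInvInvariant] (hα : IsCStarDynamicalSystem α) {F H : K → A} (hF : Integrable F μ)
    (hH : Integrable H μ) :
    ∀ᵐ τ ∂μ, Integrable (fun ρ => F ρ * α ρ (H (ρ⁻¹ * τ))) μ := by
  obtain ⟨D, hD, hDle, hDint⟩ := exists_conv_dominating hF hH one_ne_zero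
  have hfin : ∫⁻ τ, D τ ∂μ ≠ ∞ := ne_top_of_le_ne_top
    (ENNReal.mul_ne_top (ENNReal.add_ne_top.2 ⟨hF.hasFiniteIntegral.ne, ENNReal.one_ne_top⟩)
      (ENNReal.add_ne_top.2 ⟨hH.hasFiniteIntegral.ne, ENNReal.one_ne_top⟩)) hDint
  filter_upwards [ae_lt_top hD hfin] with τ hτ
  exact ⟨aestronglyMeasurable_twistedConvolution_integrand hα hF hH τ,
    ((lintegral_enorm_twistedConvolution_integrand_le F H τ).trans (hDle τ)).trans_lt hτ⟩

theorem twistedConvolution_add_left [μ.IsHaarMeasure] [μ.Regular] [μ.IsInvInvariant]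
    (hα : IsCStarDynamicalSystem α) {F F' H : K → A} (hF : Integrable F μ)
    (hF' : Integrable F' μ) (hH : Integrable H μ) :
    twistedConvolution α μ (F + F') H =ᵐ[μ]
      twistedConvolution α μ F H + twistedConvolution α μ F' H := by
  filter_upwards [ae_integrable_twistedConvolution_integrand hα hF hH,
    ae_integrable_twistedConvolution_integrand hα hF' hH] with τ h1 h2
  simp only [twistedConvolution, Pi.add_apply, add_mul]
  exact integral_add h1 h2

theorem twistedConvolution_add_right [μ.IsHaarMeasure] [μ.Regular] [μ.IsInvInvariant]
    (hα : IsCStarDynamicalSystem α) {F H H' : K → A} (hF : Integrable F μ)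
    (hH : Integrable H μ) (hH' : Integrable H' μ) :
    twistedConvolution α μ F (H + H') =ᵐ[μ]
      twistedConvolution α μ F H + twistedConvolution α μ F H' := by
  filter_upwards [ae_integrable_twistedConvolution_integrand hα hF hH,
    ae_integrable_twistedConvolution_integrand hα hF hH'] with τ h1 h2
  simp only [twistedConvolution, Pi.add_apply, map_add, mul_add]
  exact integral_add h1 h2

/-- Approximation of a twisted convolution by those of continuous functions with compact
support. -/
theorem enorm_twistedConvolution_sub_le [μ.IsHaarMeasure] [μ.Regular] [μ.IsInvInvariant]
    (hα : IsCStarDynamicalSystem α) {F F' H H' : K → A} (hF : Integrable F μ)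
    (hF' : Integrable F' μ) (hH : Integrable H μ) (hH' : Integrable H' μ) :
    ∀ᵐ τ ∂μ, ‖twistedConvolution α μ F H τ - twistedConvolution α μ F' H' τ‖ₑ ≤
      ∫⁻ ρ, ‖(F - F') ρ‖ₑ * ‖H (ρ⁻¹ * τ)‖ₑ ∂μ + ∫⁻ ρ, ‖F' ρ‖ₑ * ‖(H - H') (ρ⁻¹ * τ)‖ₑ ∂μ := by
  -- The splitting is `F ∗ H - F' ∗ H' = (F - F') ∗ H + F' ∗ (H - H')`.
  have h1 := twistedConvolution_add_left hα (hF.sub hF') hF' hH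
  have h2 := twistedConvolution_add_right hα hF' (hH.sub hH') hH'
  rw [sub_add_cancel] at h1 h2
  filter_upwards [h1, h2] with τ h1 h2
  rw [h1, Pi.add_apply, h2, Pi.add_apply, ← add_assoc, add_sub_cancel_right]
  exact (enorm_add_le _ _).trans
    (add_le_add (enorm_twistedConvolution_le _ _ τ) (enorm_twistedConvolution_le _ _ τ))

theorem aestronglyMeasurable_twistedConvolution [μ.IsHaarMeasure] [μ.Regular] [μ.IsInvInvariant]
    (hα : IsCStarDynamicalSystem α) {F H : K → A} (hF : Integrable F μ) (hH : Integrable H μ) :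
    AEStronglyMeasurable (twistedConvolution α μ F H) μ := by
  refine aestronglyMeasurable_of_approx fun ε hε => ?_
  set a := ∫⁻ ρ, ‖F ρ‖ₑ ∂μ
  set b := ∫⁻ ρ, ‖H ρ‖ₑ ∂μ
  have ha : a ≠ ∞ := hF.hasFiniteIntegral.ne
  have hb : b ≠ ∞ := hH.hasFiniteIntegral.ne
  -- The two summands are Young's bounds for `(F - u) ∗ H` and `u ∗ (H - v)`. One `δ` in each factor
  -- is the slack of the majorant, the others are approximation errors.
  have hlim : Tendsto (fun δ : ℝ≥0∞ => (δ + δ) * (b + δ) + (a + δ + δ) * (δ + δ)) (𝓝 0) (𝓝 0) := by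
    have h0 : Tendsto (fun δ : ℝ≥0∞ => δ) (𝓝 0) (𝓝 0) := tendsto_id
    have h1 := ENNReal.Tendsto.mul (h0.add h0) (b := b + 0) (Or.inr (by simpa using hb))
      (tendsto_const_nhds.add h0) (Or.inr (by simp))
    have h2 := ENNReal.Tendsto.mul ((tendsto_const_nhds (x := a).add h0).add h0)
      (Or.inr (by simp)) (h0.add h0) (Or.inr (by simpa using ha))
    simpa using h1.add h2
  obtain ⟨δ, hδε, hδ⟩ : ∃ δ : ℝ≥0∞,
      (δ + δ) * (b + δ) + (a + δ + δ) * (δ + δ) ≤ ε ∧ δ ≠ 0 := by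
    have hev := (hlim.mono_left nhdsWithin_le_nhds).eventually
      (eventually_le_nhds (pos_iff_ne_zero.2 hε)) (l₁ := 𝓝[≠] 0)
    exact (hev.and self_mem_nhdsWithin).exists
  obtain ⟨u, hu', huδ, hu, hui⟩ := exists_hasCompactSupport_lintegral_sub_le hF hδ
  obtain ⟨v, hv', hvδ, hv, hvi⟩ := exists_hasCompactSupport_lintegral_sub_le hH hδ
  obtain ⟨D, hD, hDle, hDint⟩ := exists_conv_dominating (hF.sub hui) hH hδ
  obtain ⟨D', hD', hDle', hDint'⟩ := exists_conv_dominating hui (hH.sub hvi) hδ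
  refine ⟨twistedConvolution α μ u v, fun τ => D τ + D' τ, ?_, (hD.add hD').aemeasurable, ?_, ?_⟩
  · obtain ⟨hc, hs⟩ := continuous_hasCompactSupport_twistedConvolution (μ := μ) hα hu hu' hv hv'
    exact (hc.integrable_of_hasCompactSupport hs).aestronglyMeasurable
  · filter_upwards [enorm_twistedConvolution_sub_le hα hF hui hH hvi] with τ hτ
    exact hτ.trans (add_le_add (hDle τ) (hDle' τ))
  · have hua : ∫⁻ ρ, ‖u ρ‖ₑ ∂μ ≤ a + δ := by
      have h : ∀ x, ‖u x‖ₑ ≤ ‖F x‖ₑ + ‖F x - u x‖ₑ := fun x => by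
        have h := enorm_sub_le (a := F x) (b := F x - u x)
        rwa [sub_sub_cancel] at h
      refine (lintegral_mono h).trans ?_
      rw [lintegral_add_left' hF.aestronglyMeasurable.enorm]
      gcongr
    rw [lintegral_add_left hD]
    refine le_trans (add_le_add (hDint.trans ?_) (hDint'.trans ?_)) hδε
    · exact mul_le_mul' (add_le_add huδ le_rfl) le_rfl
    · exact mul_le_mul' (add_le_add hua le_rfl) (add_le_add hvδ le_rfl)

/-- Young's inequality with slack `δ` holds for every nonzero `δ`; the slack is then sent to `0`. -/
theorem lintegral_enorm_twistedConvolution_le [μ.IsHaarMeasure] [μ.Regular] [μ.IsInvInvariant]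
    {F H : K → A} (hF : Integrable F μ) (hH : Integrable H μ) :
    ∫⁻ τ, ‖twistedConvolution α μ F H τ‖ₑ ∂μ ≤ (∫⁻ ρ, ‖F ρ‖ₑ ∂μ) * ∫⁻ ρ, ‖H ρ‖ₑ ∂μ := by
  set a := ∫⁻ ρ, ‖F ρ‖ₑ ∂μ
  set b := ∫⁻ ρ, ‖H ρ‖ₑ ∂μ
  have ha : a ≠ ∞ := hF.hasFiniteIntegral.ne
  have hb : b ≠ ∞ := hH.hasFiniteIntegral.ne
  have hlim : Tendsto (fun δ : ℝ≥0∞ => (a + δ) * (b + δ)) (𝓝[≠] 0) (𝓝 (a * b)) := by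
    have h0 : Tendsto (fun δ : ℝ≥0∞ => δ) (𝓝[≠] 0) (𝓝 0) := nhdsWithin_le_nhds
    have h1 := ENNReal.Tendsto.mul (tendsto_const_nhds (x := a).add h0)
      (Or.inr (by simpa using hb)) (tendsto_const_nhds (x := b).add h0) (Or.inr (by simpa using ha))
    simpa using h1
  refine ge_of_tendsto hlim ?_
  filter_upwards [self_mem_nhdsWithin] with δ hδ
  obtain ⟨D, -, hDle, hDint⟩ := exists_conv_dominating hF hH hδ
  exact (lintegral_mono fun τ => (enorm_twistedConvolution_le F H τ).trans (hDle τ)).trans hDint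

theorem integrable_twistedConvolution [μ.IsHaarMeasure] [μ.Regular] [μ.IsInvInvariant]
    (hα : IsCStarDynamicalSystem α) {F H : K → A} (hF : Integrable F μ) (hH : Integrable H μ) :
    Integrable (twistedConvolution α μ F H) μ :=
  ⟨aestronglyMeasurable_twistedConvolution hα hF hH,
    (lintegral_enorm_twistedConvolution_le hF hH).trans_lt
      (ENNReal.mul_lt_top hF.hasFiniteIntegral hH.hasFiniteIntegral)⟩

end TwistedConvolution

/-! ### The twisted convolution algebra -/

section TwistedConvolutionAlgebra

open scoped ENNReal

theorem exists_eq_toL1 {X E : Type*} [MeasurableSpace X] {μ : Measure X} [NormedAddCommGroup E]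
    (x : X →₁[μ] E) :
    ∃ (F : X → E) (hF : Integrable F μ), x = hF.toL1 F :=
  ⟨x, L1.integrable_coeFn x, (Integrable.toL1_coeFn x _).symm⟩

variable {K : Type*} [Group K] [TopologicalSpace K] [IsTopologicalGroup K] [T2Space K]
  [LocallyCompactSpace K] [MeasurableSpace K] [BorelSpace K] {μ : Measure K} [μ.Regular]
  [μ.IsInvInvariant] {A : Type*} [NonUnitalCStarAlgebra A] {α : K →* (A ≃⋆ₐ[ℂ] A)}

/-- The twisted involution on `L¹(K, A, α)`. -/
noncomputable def involutionL1 (hα : IsCStarDynamicalSystem α) (x : K →₁[μ] A) : K →₁[μ] A :=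
  (integrable_twistedInvolution hα (L1.integrable_coeFn x)).toL1 _

theorem involutionL1_toL1 (hα : IsCStarDynamicalSystem α) {F : K → A} (hF : Integrable F μ) :
    involutionL1 hα (hF.toL1 F) = (integrable_twistedInvolution hα hF).toL1 _ :=
  (Integrable.toL1_eq_toL1_iff _ _ _ _).2 (twistedInvolution_congr hF.coeFn_toL1)

variable [μ.IsHaarMeasure]

/-- The twisted convolution on `L¹(K, A, α)`. -/
noncomputable def convolutionL1 (hα : IsCStarDynamicalSystem α) (x y : K →₁[μ] A) : K →₁[μ] A :=
  (integrable_twistedConvolution hα (L1.integrable_coeFn x) (L1.integrable_coeFn y)).toL1 _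

theorem convolutionL1_toL1 (hα : IsCStarDynamicalSystem α) {F H : K → A} (hF : Integrable F μ)
    (hH : Integrable H μ) :
    convolutionL1 hα (hF.toL1 F) (hH.toL1 H) =
      (integrable_twistedConvolution hα hF hH).toL1 _ :=
  (Integrable.toL1_eq_toL1_iff _ _ _ _).2 <| Eventually.of_forall fun τ =>
    congrFun (twistedConvolution_congr hF.coeFn_toL1 hH.coeFn_toL1) τ

theorem convolutionL1_add_left (hα : IsCStarDynamicalSystem α) (x y z : K →₁[μ] A) :
    convolutionL1 hα (x + y) z = convolutionL1 hα x z + convolutionL1 hα y z := by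
  obtain ⟨F, hF, rfl⟩ := exists_eq_toL1 x
  obtain ⟨F', hF', rfl⟩ := exists_eq_toL1 y
  obtain ⟨H, hH, rfl⟩ := exists_eq_toL1 z
  rw [← Integrable.toL1_add]
  simp only [convolutionL1_toL1]
  rw [← Integrable.toL1_add, Integrable.toL1_eq_toL1_iff]
  exact twistedConvolution_add_left hα hF hF' hH

theorem convolutionL1_add_right (hα : IsCStarDynamicalSystem α) (x y z : K →₁[μ] A) :
    convolutionL1 hα x (y + z) = convolutionL1 hα x y + convolutionL1 hα x z := by
  obtain ⟨F, hF, rfl⟩ := exists_eq_toL1 x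
  obtain ⟨H, hH, rfl⟩ := exists_eq_toL1 y
  obtain ⟨H', hH', rfl⟩ := exists_eq_toL1 z
  rw [← Integrable.toL1_add]
  simp only [convolutionL1_toL1]
  rw [← Integrable.toL1_add, Integrable.toL1_eq_toL1_iff]
  exact twistedConvolution_add_right hα hF hH hH'

theorem convolutionL1_smul_left (hα : IsCStarDynamicalSystem α) (c : ℂ) (x y : K →₁[μ] A) :
    convolutionL1 hα (c • x) y = c • convolutionL1 hα x y := by
  obtain ⟨F, hF, rfl⟩ := exists_eq_toL1 x
  obtain ⟨H, hH, rfl⟩ := exists_eq_toL1 y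
  rw [← Integrable.toL1_smul']
  simp only [convolutionL1_toL1]
  rw [← Integrable.toL1_smul', Integrable.toL1_eq_toL1_iff, twistedConvolution_smul_left]

theorem convolutionL1_smul_right (hα : IsCStarDynamicalSystem α) (c : ℂ) (x y : K →₁[μ] A) :
    convolutionL1 hα x (c • y) = c • convolutionL1 hα x y := by
  obtain ⟨F, hF, rfl⟩ := exists_eq_toL1 x
  obtain ⟨H, hH, rfl⟩ := exists_eq_toL1 y
  rw [← Integrable.toL1_smul']
  simp only [convolutionL1_toL1]
  rw [← Integrable.toL1_smul', Integrable.toL1_eq_toL1_iff, twistedConvolution_smul_right]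

theorem norm_convolutionL1_le (hα : IsCStarDynamicalSystem α) (x y : K →₁[μ] A) :
    ‖convolutionL1 hα x y‖ ≤ ‖x‖ * ‖y‖ := by
  obtain ⟨F, hF, rfl⟩ := exists_eq_toL1 x
  obtain ⟨H, hH, rfl⟩ := exists_eq_toL1 y
  rw [convolutionL1_toL1, Integrable.norm_toL1_eq_lintegral_enorm,
    Integrable.norm_toL1_eq_lintegral_enorm, Integrable.norm_toL1_eq_lintegral_enorm,
    ← ENNReal.toReal_mul]
  exact ENNReal.toReal_mono
    (ENNReal.mul_ne_top hF.hasFiniteIntegral.ne hH.hasFiniteIntegral.ne)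
    (lintegral_enorm_twistedConvolution_le hF hH)

theorem continuous_convolutionL1 (hα : IsCStarDynamicalSystem α) :
    Continuous fun p : (K →₁[μ] A) × (K →₁[μ] A) => convolutionL1 hα p.1 p.2 :=
  let B : (K →₁[μ] A) →L[ℂ] (K →₁[μ] A) →L[ℂ] (K →₁[μ] A) :=
    LinearMap.mkContinuous₂
      (LinearMap.mk₂ ℂ (convolutionL1 hα) (convolutionL1_add_left hα)
        (convolutionL1_smul_left hα) (convolutionL1_add_right hα)
        fun c x y => convolutionL1_smul_right hα c x y) 1
      fun x y => by simpa using norm_convolutionL1_le hα x y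
  B.continuous₂

/-- Continuous functions with compact support are dense in `L¹`. -/
theorem denseRange_toL1_hasCompactSupport {X E : Type*} [TopologicalSpace X] [T2Space X]
    [LocallyCompactSpace X] [MeasurableSpace X] [BorelSpace X] {μ : Measure X} [μ.Regular]
    [NormedAddCommGroup E] [NormedSpace ℝ E] :
    DenseRange fun F : {F : X → E // Continuous F ∧ HasCompactSupport F} =>
      (F.2.1.integrable_of_hasCompactSupport F.2.2 : Integrable F.1 μ).toL1 F.1 := by
  intro x
  obtain ⟨F, hF, rfl⟩ := exists_eq_toL1 x
  refine EMetric.mem_closure_iff.2 fun ε hε => ?_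
  obtain ⟨δ, hδ, hδε⟩ := exists_between hε
  obtain ⟨g, hg, hgδ, hgc, hgi⟩ := exists_hasCompactSupport_lintegral_sub_le hF hδ.ne'
  refine ⟨_, ⟨⟨g, hgc, hg⟩, rfl⟩, lt_of_le_of_lt ?_ hδε⟩
  rw [Integrable.edist_toL1_toL1]
  simpa only [edist_eq_enorm_sub] using hgδ

/-- Both sides are jointly continuous in the three arguments and agree on a dense subset. -/
theorem convolutionL1_assoc (hα : IsCStarDynamicalSystem α) (x y z : K →₁[μ] A) :
    convolutionL1 hα (convolutionL1 hα x y) z = convolutionL1 hα x (convolutionL1 hα y z) := by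
  have hc := continuous_convolutionL1 (μ := μ) hα
  refine denseRange_toL1_hasCompactSupport.induction_on₃
    (p := fun x y z => convolutionL1 hα (convolutionL1 hα x y) z =
      convolutionL1 hα x (convolutionL1 hα y z)) ?_ ?_ x y z
  · exact isClosed_eq
      (hc.comp ((hc.comp (continuous_fst.prodMk continuous_snd.fst)).prodMk continuous_snd.snd))
      (hc.comp (continuous_fst.prodMk (hc.comp continuous_snd)))
  · rintro ⟨F, hF, hF'⟩ ⟨H, hH, hH'⟩ ⟨L, hL, hL'⟩
    simp only [convolutionL1_toL1]
    rw [Integrable.toL1_eq_toL1_iff,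
      twistedConvolution_assoc_of_hasCompactSupport hα hF hF' hH hH' hL]

/-- `L¹(K, A, α)` is a Banach `*`-algebra for every `C*`-dynamical system `(K, A, α)` with
unimodular `K`. -/
theorem isTwistedConvolutionAlgebra_of_isInvInvariant (hα : IsCStarDynamicalSystem α) :
    IsTwistedConvolutionAlgebra α μ := by
  refine ⟨convolutionL1 hα, involutionL1 hα, fun F H hF hH => ⟨?_, ?_⟩, fun F hF => ?_, ?_⟩
  · exact ae_integrable_twistedConvolution_integrand hα hF hH
  · rw [convolutionL1_toL1]
    exact Integrable.coeFn_toL1 _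
  · rw [involutionL1_toL1]
    exact Integrable.coeFn_toL1 _
  exact
    { complete := inferInstance
      add_mul := convolutionL1_add_left hα
      mul_add := convolutionL1_add_right hα
      smul_mul := convolutionL1_smul_left hα
      mul_smul := convolutionL1_smul_right hα
      mul_assoc := convolutionL1_assoc hα
      norm_mul_le := norm_convolutionL1_le hα
      inv_inv := by
        intro x
        obtain ⟨F, hF, rfl⟩ := exists_eq_toL1 x
        rw [involutionL1_toL1, involutionL1_toL1, Integrable.toL1_eq_toL1_iff,
          twistedInvolution_twistedInvolution]
      inv_add := by
        intro x y
        obtain ⟨F, hF, rfl⟩ := exists_eq_toL1 x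
        obtain ⟨H, hH, rfl⟩ := exists_eq_toL1 y
        rw [← Integrable.toL1_add]
        simp only [involutionL1_toL1]
        rw [← Integrable.toL1_add, Integrable.toL1_eq_toL1_iff]
        refine Eventually.of_forall fun ρ => ?_
        simp only [twistedInvolution, Pi.add_apply, star_add, map_add]
      inv_smul := by
        intro c x
        obtain ⟨F, hF, rfl⟩ := exists_eq_toL1 x
        rw [← Integrable.toL1_smul', involutionL1_toL1, involutionL1_toL1,
          ← Integrable.toL1_smul', Integrable.toL1_eq_toL1_iff]
        refine Eventually.of_forall fun ρ => ?_
        simp only [twistedInvolution, Pi.smul_apply, star_smul, map_smul]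
      inv_mul := by
        intro x y
        obtain ⟨F, hF, rfl⟩ := exists_eq_toL1 x
        obtain ⟨H, hH, rfl⟩ := exists_eq_toL1 y
        simp only [convolutionL1_toL1, involutionL1_toL1]
        rw [Integrable.toL1_eq_toL1_iff, twistedInvolution_twistedConvolution]
      norm_inv := by
        intro x
        obtain ⟨F, hF, rfl⟩ := exists_eq_toL1 x
        rw [involutionL1_toL1, Integrable.norm_toL1_eq_lintegral_enorm,
          Integrable.norm_toL1_eq_lintegral_enorm, lintegral_enorm_twistedInvolution] }

end TwistedConvolutionAlgebra

theorem mainTheorem10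
    {M : Type u} [TopologicalSpace M]
    {G : Type v} [Group G] [TopologicalSpace G] [IsTopologicalGroup G] [T2Space G]
    [LocallyCompactSpace G]
    (unimodular : ∀ g : G, Measure.modularCharacter g = 1)
    {N : ℕ} (Γ : Graph M N) (S : Fin N → OrientedSurface M)
    (hS : SimpleSurfaceIntersectionProperty Γ S)
    [MeasurableSpace (fluxGroup G Γ S)] [BorelSpace (fluxGroup G Γ S)]
    (μ : Measure (fluxGroup G Γ S)) [μ.IsHaarMeasure] [μ.Regular] :
    IsCStarDynamicalSystem (leftAction (G := G) Γ S) ∧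
      IsTwistedConvolutionAlgebra (leftAction (G := G) Γ S) μ ∧
      ∀ α : fluxGroup G Γ S →* (C₀(configSpace G Γ, ℂ) ≃⋆ₐ[ℂ] C₀(configSpace G Γ, ℂ)),
        IsCStarDynamicalSystem α → IsTwistedConvolutionAlgebra α μ := by
  -- Local compactness and unimodularity are both transported along the identification with `G ^ N`.
  have : LocallyCompactSpace (fluxGroup G Γ S) :=
    (ingoingFluxEquiv G hS).toHomeomorph.isClosedEmbedding.locallyCompactSpace
  have : μ.IsInvInvariant := isInvInvariant_of_modularCharacter_eq_one μ
    (modularCharacter_eq_one_of_continuousMulEquiv_pi (ingoingFluxEquiv G hS) unimodular)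
  have hleft : IsCStarDynamicalSystem (leftAction (G := G) Γ S) :=
    ⟨inferInstance, continuous_leftAction_apply⟩
  exact ⟨hleft, isTwistedConvolutionAlgebra_of_isInvInvariant hleft,
    fun α hα => isTwistedConvolutionAlgebra_of_isInvInvariant hα⟩
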